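/- **Model.** For $n,\mu\ge 1$ the preferential attachment multigraph $G_{pa}(n,\mu)$ is generated as follows. In round $i=1,\dots,n$ a new vertex $v_i$ arrives and $\mu$ edges are added one after the other, each from $v_i$ to a random vertex among $v_1,\dots,v_i$; with $d_{v}$ the current degrees (a self-loop counts twice), the other end is $v_j$ with probability $d_{v_j}/(\sum_{k\le i}d_{v_k}+1)$ if $j<i$ and $(d_{v_i}+1)/(\sum_{k\le i}d_{v_k}+1)$ if $j=i$. Finally the vertices are relabelled by a uniformly random permutation of $[n]$. An algorithm has probe access to a multigraph $G$ on $[n]$ whose adjacency lists (with multiplicity, a self-loop listed twice) are in arbitrary order: $\mathrm{Deg}(v)$ returns the degree $d_v$, $\mathrm{Nbr}(v,i)$ the $i$-th entry of the list of $v$ ($\bot$ if there is none or if the entry repeats an earlier one), and $\mathrm{Exists}(u,v)$ whether $u,v$ are adjacent. The parallel edges between $u$ and $v$ are numbered $1,2,\dots$; an admissible query $(u,v,i)$ asks whether the $i$-th edge of $G$ between $u$ and $v$ belongs to a subgraph $H$. Every query is answered from a fresh memory by one fixed program. Time counts every probe and every elementary operation on registers (assigning a constant, copying, adding one, comparing)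 as one step. A spanning subgraph $H\subseteq G$ is a $k$-spanner if $\mathrm{dist}_H(u,v)\le k\,\mathrm{dist}_G(u,v)$ for all $u,v$ that are connected in $G$ (and these are then connected in $H$). For a multigraph $G$ on $[n]$, let $H(G)$ be the subgraph in which every vertex $u$ having a neighbour other than itself keeps the first edge to its highest-degree neighbour $v\ne u$ (of several such neighbours, the one with the largest label). **Theorem.** There are absolute constants $c_\mu,C>0$ and a single deterministic program (independent of $n$ and $\mu$) with the following properties. 1. For every $n$, every multigraph $G$ on $[n]$ and every order of its adjacency lists, the program answers every admissible query $(u,v,i)$ correctly with respect to $H(G)$, in time at most $C(d_u+d_v)$. 2. For all integers $n\ge 2$ and $\mu>c_\mu\log n$, with probability at least $1-1/n$ over $G\leftarrow G_{pa}(n,\mu)$: the subgraph $H(G)$ is a $(C\log n)$-spanner of $G$ and has exactly $n-1$ edges, and, for every order of the adjacency lists, the time of the program is at most $C\mu\sqrt n$ on every admissible query and at most $C\mu\log^3 n$ on average over all admissible queries. -/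

import Mathlib

namespace PALCA

open scoped ENNReal

/-! ### Multigraphs on `n` labelled vertices -/

/-- A finite multigraph with vertex set `Fin n`: a multiset of unordered pairs.
Parallel edges and self-loops are allowed. -/
abbrev MGraph (n : ℕ) : Type := Multiset (Sym2 (Fin n))

/-- The number of edge ends at `v` whose other end is at `u`; a self-loop at `v` has two of them. -/
def MGraph.ends {n : ℕ} (G : MGraph n) (v u : Fin n) : ℕ :=
  if u = v then 2 * G.count s(v, v) else G.count s(v, u)

/-- The degree, with multiplicity; a self-loop counts twice. -/
def MGraph.deg {n : ℕ} (G : MGraph n) (v : Fin n) : ℕ := ∑ u, G.ends v u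

/-- A single edge of a multigraph is a pair `(e, i)`: the `i`-th of the parallel edges
(numbered from `1`) with the ends `e`. -/
def MGraph.edges {n : ℕ} (G : MGraph n) : Set (Sym2 (Fin n) × ℕ) :=
  {p | 1 ≤ p.2 ∧ p.2 ≤ G.count p.1}

/-- The simple graph that determines the distances in a set of edges: parallel edges are
identified and self-loops are dropped. -/
def underlying {n : ℕ} (H : Set (Sym2 (Fin n) × ℕ)) : SimpleGraph (Fin n) :=
  SimpleGraph.fromEdgeSet {e | ∃ i, (e, i) ∈ H}

/-- The subgraph `H` of `G` (on all the vertices of `G`) is a `k`-spanner of `G`. -/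
def IsSpanner {n : ℕ} (G : MGraph n) (H : Set (Sym2 (Fin n) × ℕ)) (k : ℝ) : Prop :=
  H ⊆ G.edges ∧
    ∀ u v : Fin n, (underlying G.edges).Reachable u v →
      (underlying H).Reachable u v ∧
        ((underlying H).dist u v : ℝ) ≤ k * ((underlying G.edges).dist u v : ℝ)

/-! ### Preferential attachment -/

/-- The unnormalised probability that an edge inserted from `i` goes to `j`. -/
def attachWeight {n : ℕ} (G : MGraph n) (i j : Fin n) : ℕ :=
  if j < i then G.deg j else if j = i then G.deg j + 1 else 0

theorem sum_attachWeight {n : ℕ} (G : MGraph n) (i : Fin n) :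
    ∑ j, attachWeight G i j = (∑ j ∈ Finset.Iic i, G.deg j) + 1 := by
  have h : ∀ j, attachWeight G i j =
      (if j ∈ Finset.Iic i then G.deg j else 0) + (if j = i then 1 else 0) := by
    intro j
    unfold attachWeight
    rcases lt_trichotomy j i with h | h | h
    · simp [h, h.le, h.ne]
    · simp [h]
    · simp [h.not_gt, h.ne', h.not_ge]
  simp only [h, Finset.sum_add_distrib, Finset.sum_ite_mem, Finset.univ_inter,
    Finset.sum_ite_eq', Finset.mem_univ, if_true]

/-- The random end `j` of a new edge from `i`: its law is `d_j / (∑_{j ≤ i} d_j + 1)` for `j < i`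
and `(d_i + 1) / (∑_{j ≤ i} d_j + 1)` for `j = i`. -/
noncomputable def attach {n : ℕ} (G : MGraph n) (i : Fin n) : PMF (Fin n) :=
  PMF.ofFintype
    (fun j => (attachWeight G i j : ℝ≥0∞) / (((∑ k ∈ Finset.Iic i, G.deg k) + 1 : ℕ) : ℝ≥0∞))
    (by
      simp only [div_eq_mul_inv]
      rw [← Finset.sum_mul, ← Nat.cast_sum, sum_attachWeight]
      exact ENNReal.mul_inv_cancel (by simp) (ENNReal.natCast_ne_top _))

/-- Insert `k` edges from `i`, one after the other; each uses the degrees at that moment. -/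
noncomputable def attachMany {n : ℕ} (i : Fin n) : ℕ → MGraph n → PMF (MGraph n)
  | 0, G => PMF.pure G
  | k + 1, G => (attach G i).bind fun j => attachMany i k (s(i, j) ::ₘ G)

/-- The preferential attachment process; the vertex `i` arrives in round `i`, and inserts `μ`
edges. -/
noncomputable def process (n μ : ℕ) : PMF (MGraph n) :=
  (List.finRange n).foldl (fun p i => p.bind (attachMany i μ)) (PMF.pure 0)

/-- The preferential attachment graph: the process, followed by a uniformly random relabelling
of the vertices. -/
noncomputable def Gpa (n μ : ℕ) : PMF (MGraph n) :=
  (process n μ).bind fun G =>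
    (PMF.uniformOfFintype (Equiv.Perm (Fin n))).map fun σ => G.map (Sym2.map σ)

/-! ### Probe access -/

/-- An adjacency list representation of `G`: the neighbours of every vertex are listed with
multiplicity (a self-loop twice), in an arbitrary order. -/
structure AdjLists {n : ℕ} (G : MGraph n) where
  list : Fin n → List (Fin n)
  count_list : ∀ v u, (list v).count u = G.ends v u

/-- The vertices `0, …, n - 1` of `Fin n` have the identifiers `1, …, n`; the number `0` stands
for `⊥`. -/
def ident {n : ℕ} (v : Fin n) : ℕ := v.val + 1

/-- The vertex with a given identifier. -/
def vertex (n a : ℕ) : Option (Fin n) :=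
  if h : 1 ≤ a ∧ a ≤ n then some ⟨a - 1, by omega⟩ else none

/-- `Deg(v)`. -/
def degProbe {n : ℕ} (G : MGraph n) (a : ℕ) : ℕ :=
  match vertex n a with
  | none => 0
  | some v => G.deg v

/-- `Exists(u, v)`, with `1` for true and `0` for false. -/
def existsProbe {n : ℕ} (G : MGraph n) (a b : ℕ) : ℕ :=
  match vertex n a, vertex n b with
  | some u, some v => if s(u, v) ∈ G then 1 else 0
  | _, _ => 0

/-- `Nbr(v, i)`: the `i`-th entry (from `1`) of the adjacency list of `v`; the answer is `⊥` if
there is no such entry, or if the same neighbour already occurs earlier in the list. -/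
def nbrProbe {n : ℕ} {G : MGraph n} (A : AdjLists G) (a i : ℕ) : ℕ :=
  match vertex n a, i with
  | some v, k + 1 =>
    match (A.list v)[k]? with
    | some w => if w ∈ (A.list v).take k then 0 else ident w
    | none => 0
  | _, _ => 0

/-! ### Programs with probes, and their running time -/

/-- Programs over registers `0, 1, 2, …` that hold natural numbers. A program mentions finitely
many registers. Besides the probes it can only assign a constant, copy, add one, and compare, so
that every number it computes is a constant, an answer or an input plus at most the elapsed
time. -/
inductive Prog : Type
  | const (x c : ℕ)
  | copy (x y : ℕ)
  | succ (x : ℕ)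
  | deg (x y : ℕ)
  | nbr (x y z : ℕ)
  | edge (x y z : ℕ)
  | seq (P Q : Prog)
  | ifLt (x y : ℕ) (P Q : Prog)
  | whileLt (x y : ℕ) (P : Prog)

/-- `Exec A P s t s'`: started in the register contents `s`, the program `P`, probing the graph
that is represented by `A`, stops after `t` steps in the register contents `s'`. Every assignment,
every probe and every comparison is one step. -/
inductive Exec {n : ℕ} {G : MGraph n} (A : AdjLists G) :
    Prog → (ℕ → ℕ) → ℕ → (ℕ → ℕ) → Prop
  | const (x c : ℕ) (s : ℕ → ℕ) : Exec A (.const x c) s 1 (Function.update s x c)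
  | copy (x y : ℕ) (s : ℕ → ℕ) : Exec A (.copy x y) s 1 (Function.update s x (s y))
  | succ (x : ℕ) (s : ℕ → ℕ) : Exec A (.succ x) s 1 (Function.update s x (s x + 1))
  | deg (x y : ℕ) (s : ℕ → ℕ) :
      Exec A (.deg x y) s 1 (Function.update s x (degProbe G (s y)))
  | nbr (x y z : ℕ) (s : ℕ → ℕ) :
      Exec A (.nbr x y z) s 1 (Function.update s x (nbrProbe A (s y) (s z)))
  | edge (x y z : ℕ) (s : ℕ → ℕ) :
      Exec A (.edge x y z) s 1 (Function.update s x (existsProbe G (s y) (s z)))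
  | seq {P Q : Prog} {s₁ s₂ s₃ : ℕ → ℕ} {t₁ t₂ : ℕ} :
      Exec A P s₁ t₁ s₂ → Exec A Q s₂ t₂ s₃ → Exec A (.seq P Q) s₁ (t₁ + t₂) s₃
  | ifTrue {x y : ℕ} {P Q : Prog} {s₁ s₂ : ℕ → ℕ} {t : ℕ} :
      s₁ x < s₁ y → Exec A P s₁ t s₂ → Exec A (.ifLt x y P Q) s₁ (t + 1) s₂
  | ifFalse {x y : ℕ} {P Q : Prog} {s₁ s₂ : ℕ → ℕ} {t : ℕ} :
      ¬ s₁ x < s₁ y → Exec A Q s₁ t s₂ → Exec A (.ifLt x y P Q) s₁ (t + 1) s₂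
  | whileTrue {x y : ℕ} {P : Prog} {s₁ s₂ s₃ : ℕ → ℕ} {t₁ t₂ : ℕ} :
      s₁ x < s₁ y → Exec A P s₁ t₁ s₂ → Exec A (.whileLt x y P) s₂ t₂ s₃ →
        Exec A (.whileLt x y P) s₁ (t₁ + t₂ + 1) s₃
  | whileFalse {x y : ℕ} {P : Prog} {s : ℕ → ℕ} :
      ¬ s x < s y → Exec A (.whileLt x y P) s 1 s

/-- A query `(u, v, i)` asks for the `i`-th edge between `u` and `v`. -/
abbrev Query (n : ℕ) : Type := Fin n × Fin n × ℕ

/-- The edge that a query asks for. -/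
def Query.edge {n : ℕ} (q : Query n) : Sym2 (Fin n) × ℕ := (s(q.1, q.2.1), q.2.2)

/-- The memory at the start of a query: the query itself, and nothing else. -/
def Query.init {n : ℕ} (q : Query n) : ℕ → ℕ := fun r =>
  if r = 0 then ident q.1 else if r = 1 then ident q.2.1 else if r = 2 then q.2.2 else 0

/-- The admissible queries for `G`: those that ask for an edge of `G`. -/
def queries {n : ℕ} (G : MGraph n) : Finset (Query n) :=
  (Finset.univ ×ˢ Finset.univ ×ˢ Finset.range (G.card + 1)).filter
    fun q => 1 ≤ q.2.2 ∧ q.2.2 ≤ G.count s(q.1, q.2.1)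

/-- `P` gives local access to `H` in the running time `T`: on every admissible query, starting
from a fresh memory, `P` stops after `T q` steps, and register `0` is then nonzero exactly if the
edge asked for is in `H`. -/
def GivesAccess {n : ℕ} {G : MGraph n} (A : AdjLists G) (P : Prog)
    (H : Set (Sym2 (Fin n) × ℕ)) (T : Query n → ℕ) : Prop :=
  ∀ q ∈ queries G, ∃ s : ℕ → ℕ, Exec A P q.init (T q) s ∧ (s 0 ≠ 0 ↔ q.edge ∈ H)

/-- The average of `T` over all admissible queries. -/
noncomputable def avgTime {n : ℕ} (G : MGraph n) (T : Query n → ℕ) : ℝ :=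
  (∑ q ∈ queries G, (T q : ℝ)) / ((queries G).card : ℝ)

/-! ### The spanner -/

/-- `v` is the highest-degree neighbour of `u` (other than `u` itself); among neighbours of equal
degree the one with the largest identifier is preferred. -/
def IsTopNbr {n : ℕ} (G : MGraph n) (u v : Fin n) : Prop :=
  v ≠ u ∧ s(u, v) ∈ G ∧
    ∀ w, w ≠ u → s(u, w) ∈ G → G.deg w < G.deg v ∨ (G.deg w = G.deg v ∧ w ≤ v)

/-- Every vertex keeps the first of the edges to its highest-degree neighbour. -/
def topSpanner {n : ℕ} (G : MGraph n) : Set (Sym2 (Fin n) × ℕ) :=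
  {p | p.2 = 1 ∧ ∃ u v, p.1 = s(u, v) ∧ IsTopNbr G u v}

end PALCA

open PALCA

namespace PALCA

open scoped ENNReal

/-! ### Degrees -/

section Degrees

variable {n : ℕ}

/-! While later vertices insert edges, an edge added to a graph with `e` edges raises a degree `d`
with probability `d / (2e + 1)`, so `d / growth e` is a martingale and `growth e` is of order `√e`.
The vertex that arrives in position `i` should thus end with degree about `μ √(n / i)`.
Concentration comes from the supermartingale `(1 - α / growth e)⁻¹ ^ d` (`moment_step`): positive
`α` bounds the upper tail (`expect_large_deg`), negative `α` the lower one (`expect_small_deg`),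
each up to an error exponentially small in `μ`.

Every earlier vertex already has degree at least `μ`, so an edge inserted by `i` hits a set `A` of
earlier vertices with probability at least about `|A| / (2i)`, and all `μ` edges miss it with
probability at most `exp (-μ |A| / (2i))` (`expect_misses`). Hence, for `μ` a large multiple of `log
n`, a union bound shows that the first constantly many vertices form a clique and that every later
vertex has a neighbour arriving earlier by the factor `coreSize`. By the degree estimates this
neighbour has at least twice the degree.

The map to the highest-degree neighbour therefore doubles degrees until it enters the clique, and
from there it reaches the vertex of maximal degree in one step. Degrees differ by a factor
polynomial in `n`, so the depth is logarithmic and the kept edges form a tree (`isSpanner_of_core`).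

A query is answered by scanning the lists of both ends, at a cost proportional to the sum of their
degrees (`spannerProg_exec`). The maximum degree is `O(μ √n)`. Averaging over the queries leads to
`∑ deg² / (μ n)`, and `deg²` is `O(μ² n / i)`, so the harmonic sum gives `O(μ log n)`, which is
stronger than the required bound. -/

theorem ends_cons (G : MGraph n) (a b v u : Fin n) :
    MGraph.ends (s(a, b) ::ₘ G) v u = G.ends v u +
      ((if v = a ∧ u = b then 1 else 0) + (if v = b ∧ u = a then 1 else 0)) := by
  unfold MGraph.ends
  by_cases h : u = v
  · subst h
    simp only [if_true, Multiset.count_cons, Sym2.eq_iff]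
    by_cases h1 : u = a <;> by_cases h2 : u = b <;> simp [h1, h2] <;> grind
  · simp only [h, if_false, Multiset.count_cons, Sym2.eq_iff]
    by_cases h1 : v = a ∧ u = b <;> by_cases h2 : v = b ∧ u = a <;> simp [h1, h2] <;> grind

theorem deg_cons (G : MGraph n) (a b v : Fin n) :
    MGraph.deg (s(a, b) ::ₘ G) v = G.deg v +
      ((if v = a then 1 else 0) + (if v = b then 1 else 0)) := by
  unfold MGraph.deg
  simp only [ends_cons, Finset.sum_add_distrib]
  congr 2
  · by_cases h : v = a <;> simp [h]
  · by_cases h : v = b <;> simp [h]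

@[simp] theorem deg_zero (v : Fin n) : MGraph.deg (0 : MGraph n) v = 0 := by
  simp [MGraph.deg, MGraph.ends]

theorem sum_deg (G : MGraph n) : ∑ v, G.deg v = 2 * Multiset.card G := by
  induction G using Multiset.induction with
  | empty => simp
  | cons e G ih =>
    induction e with
    | _ a b => simp [deg_cons, Finset.sum_add_distrib, ih]; ring

theorem deg_le_deg_cons (G : MGraph n) (e : Sym2 (Fin n)) (v : Fin n) :
    G.deg v ≤ MGraph.deg (e ::ₘ G) v := by
  induction e with
  | _ a b => rw [deg_cons]; omega

/-- All edges of `G` have their ends among the first `m` vertices. -/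
def Within (m : ℕ) (G : MGraph n) : Prop := ∀ a b, s(a, b) ∈ G → a.val < m

theorem Within.deg_eq_zero {m : ℕ} {G : MGraph n} (h : Within m G) {v : Fin n} (hv : m ≤ v.val) :
    G.deg v = 0 := by
  unfold MGraph.deg
  refine Finset.sum_eq_zero fun u _ => ?_
  have : ∀ w, G.count s(v, w) = 0 := fun w =>
    Multiset.count_eq_zero.2 fun hw => absurd (h v w hw) (by omega)
  simp [MGraph.ends, this]

theorem Within.cons {m : ℕ} {G : MGraph n} (h : Within m G) {a b : Fin n} (ha : a.val < m)
    (hb : b.val < m) : Within m (s(a, b) ::ₘ G) := by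
  intro x y hxy
  rcases Multiset.mem_cons.1 hxy with h' | h'
  · rcases Sym2.eq_iff.1 h' with ⟨rfl, rfl⟩ | ⟨rfl, rfl⟩ <;> assumption
  · exact h x y h'

theorem Within.mono {m m' : ℕ} {G : MGraph n} (h : Within m G) (hm : m ≤ m') : Within m' G :=
  fun a b hab => (h a b hab).trans_le hm

/-- Vertices that have not arrived have degree zero, so the normalising constant of `attach` depends
only on the number of edges. -/
theorem Within.sum_deg {G : MGraph n} {i : Fin n} (h : Within (i.val + 1) G) :
    ∑ k ∈ Finset.Iic i, G.deg k = 2 * Multiset.card G := by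
  rw [← PALCA.sum_deg]
  refine Finset.sum_subset (Finset.subset_univ _) fun x _ hx => h.deg_eq_zero ?_
  simp only [Finset.mem_Iic, not_le] at hx
  exact hx

end Degrees

/-! ### Expectations -/

section Expectation

/-- The expectation of a nonnegative function. -/
noncomputable def expect {α : Type*} (p : PMF α) (f : α → ℝ≥0∞) : ℝ≥0∞ := ∑' a, p a * f a

variable {α β : Type*}

theorem expect_pure (a : α) (f : α → ℝ≥0∞) : expect (PMF.pure a) f = f a := by
  classical
  unfold expect
  rw [tsum_eq_single a]
  · simp
  · intro b hb; simp [PMF.pure_apply, hb]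

theorem expect_bind (p : PMF α) (g : α → PMF β) (f : β → ℝ≥0∞) :
    expect (p.bind g) f = expect p fun a => expect (g a) f := by
  unfold expect
  simp only [PMF.bind_apply, ← ENNReal.tsum_mul_right, ← ENNReal.tsum_mul_left]
  rw [ENNReal.tsum_comm]
  simp only [mul_assoc]

theorem expect_mono {p : PMF α} {f g : α → ℝ≥0∞} (h : ∀ a ∈ p.support, f a ≤ g a) :
    expect p f ≤ expect p g := by
  refine ENNReal.tsum_le_tsum fun a => ?_
  by_cases ha : a ∈ p.support
  · gcongr; exact h a ha
  · rw [(PMF.apply_eq_zero_iff p a).2 ha]; simp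

theorem expect_const (p : PMF α) (c : ℝ≥0∞) : expect p (fun _ => c) = c := by
  unfold expect
  rw [ENNReal.tsum_mul_right, p.tsum_coe, one_mul]

theorem expect_le {p : PMF α} {f : α → ℝ≥0∞} {c : ℝ≥0∞} (h : ∀ a ∈ p.support, f a ≤ c) :
    expect p f ≤ c := (expect_mono h).trans (expect_const p c).le

theorem expect_add (p : PMF α) (f g : α → ℝ≥0∞) :
    expect p (fun a => f a + g a) = expect p f + expect p g := by
  unfold expect
  simp only [mul_add]
  exact ENNReal.tsum_add

theorem expect_sum {ι : Type*} (p : PMF α) (s : Finset ι) (f : ι → α → ℝ≥0∞) :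
    expect p (fun a => ∑ i ∈ s, f i a) = ∑ i ∈ s, expect p (f i) := by
  classical
  induction s using Finset.induction with
  | empty => simpa using expect_const p 0
  | insert i s hi ih => simp only [Finset.sum_insert hi, expect_add, ih]

theorem expect_mul_const (p : PMF α) (f : α → ℝ≥0∞) (c : ℝ≥0∞) :
    expect p (fun a => f a * c) = expect p f * c := by
  unfold expect
  rw [← ENNReal.tsum_mul_right]
  simp only [mul_assoc]

end Expectation

/-! ### One attachment step, and the process split into rounds -/

section Attachment

variable {n : ℕ}

theorem sum_attachWeight_of_within {G : MGraph n} {i : Fin n} (h : Within (i.val + 1) G) :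
    ∑ j, (attachWeight G i j : ℝ) = 2 * Multiset.card G + 1 := by
  rw [← Nat.cast_sum, sum_attachWeight, h.sum_deg]; push_cast; ring

theorem expect_attach {G : MGraph n} {i : Fin n} (h : Within (i.val + 1) G) (f : Fin n → ℝ)
    (hf : ∀ j, 0 ≤ f j) :
    expect (attach G i) (fun j => ENNReal.ofReal (f j)) =
      ENNReal.ofReal ((∑ j, (attachWeight G i j : ℝ) * f j) / (2 * Multiset.card G + 1)) := by
  unfold expect
  rw [tsum_fintype, Finset.sum_div, ENNReal.ofReal_sum_of_nonneg]
  · refine Finset.sum_congr rfl fun j _ => ?_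
    simp only [attach, PMF.ofFintype_apply, h.sum_deg]
    rw [mul_div_right_comm, ENNReal.ofReal_mul (by positivity),
      ENNReal.ofReal_div_of_pos (by positivity), ENNReal.ofReal_natCast]
    congr 2
    rw [← ENNReal.ofReal_natCast]
    push_cast
    rfl
  · intro j _
    have := hf j
    positivity

theorem mem_support_attach {G : MGraph n} {i j : Fin n} (h : j ∈ (attach G i).support) :
    j ≤ i := by
  by_contra hj
  rw [PMF.mem_support_iff] at h
  apply h
  simp only [attach, PMF.ofFintype_apply, attachWeight]
  rw [if_neg (by omega), if_neg (by omega)]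
  simp

/-- A function that decreases when edges are inserted. -/
def Decreasing (f : MGraph n → ℝ≥0∞) : Prop := ∀ e G, f (e ::ₘ G) ≤ f G

theorem Decreasing.expect_attachMany {f : MGraph n → ℝ≥0∞} (hf : Decreasing f) (i : Fin n)
    (k : ℕ) (G : MGraph n) : expect (attachMany i k G) f ≤ f G := by
  induction k generalizing G with
  | zero => simp [attachMany, expect_pure]
  | succ k ih =>
    rw [attachMany, expect_bind]
    exact expect_le fun j _ => (ih _).trans (hf _ _)

/-- The index of the invariant `p` is the number of edges still to be inserted in the round. -/
theorem attachMany_induction {i : Fin n} (p : ℕ → MGraph n → Prop)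
    (step : ∀ k G j, j ≤ i → p (k + 1) G → p k (s(i, j) ::ₘ G)) {k : ℕ} {G G' : MGraph n}
    (h : p k G) (hG' : G' ∈ (attachMany i k G).support) : p 0 G' := by
  induction k generalizing G with
  | zero =>
    simp only [attachMany, PMF.support_pure, Set.mem_singleton_iff] at hG'
    exact hG' ▸ h
  | succ k ih =>
    simp only [attachMany, PMF.mem_support_bind_iff] at hG'
    obtain ⟨j, hj, hG'⟩ := hG'
    exact ih (step k G j (mem_support_attach hj) h) hG'

/-- The state of the process after `m` rounds. -/
noncomputable def rounds (n μ : ℕ) : ℕ → PMF (MGraph n)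
  | 0 => PMF.pure 0
  | m + 1 => if h : m < n then (rounds n μ m).bind (attachMany ⟨m, h⟩ μ) else rounds n μ m

theorem rounds_succ {μ m : ℕ} (h : m < n) :
    rounds n μ (m + 1) = (rounds n μ m).bind (attachMany ⟨m, h⟩ μ) := by
  rw [rounds, dif_pos h]

theorem process_eq_rounds (n μ : ℕ) : process n μ = rounds n μ n := by
  have key : ∀ m ≤ n, ((List.finRange n).take m).foldl
      (fun p i => p.bind (attachMany i μ)) (PMF.pure 0) = rounds n μ m := by
    intro m hm
    induction m with
    | zero => simp [rounds]
    | succ m ih =>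
      have hm' : m < n := hm
      rw [rounds_succ hm', ← ih hm'.le, List.take_add_one]
      simp [hm']
  rw [process, ← key n le_rfl, List.take_of_length_le (by simp)]

/-- What is certain after `m` rounds. -/
structure AfterRounds (μ m : ℕ) (G : MGraph n) : Prop where
  within : Within m G
  card : Multiset.card G = μ * m
  le_deg : ∀ v : Fin n, v.val < m → μ ≤ G.deg v
  deg_le : ∀ v : Fin n, v.val + 1 = m → G.deg v ≤ 2 * μ

theorem AfterRounds.attachMany {μ : ℕ} {i : Fin n} {G G' : MGraph n}
    (h : AfterRounds μ i.val G) (hG' : G' ∈ (attachMany i μ G).support) :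
    AfterRounds μ (i.val + 1) G' := by
  have := attachMany_induction (i := i)
    -- Each new edge adds one or two (a self-loop) to the degree of `i`; the two last inequalities
    -- track the extremes with `k` edges to go.
    (fun k G' => Within (i.val + 1) G' ∧ Multiset.card G' + k = μ * (i.val + 1) ∧
      (∀ v : Fin n, v < i → μ ≤ G'.deg v) ∧ μ ≤ G'.deg i + k ∧ G'.deg i + 2 * k ≤ 2 * μ) ?_
    (k := μ) (G := G) ?_ hG'
  · obtain ⟨h1, h2, h3, h4, h5⟩ := this
    refine ⟨h1, by simpa using h2, fun v hv => ?_, fun v hv => ?_⟩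
    · rcases (Nat.lt_succ_iff_lt_or_eq.1 hv) with hv | hv
      · exact h3 v hv
      · rw [Fin.ext hv]; simpa using h4
    · have : v = i := Fin.ext (by omega)
      rw [this]; simpa using h5
  · rintro k H j hj ⟨h1, h2, h3, h4, h5⟩
    refine ⟨h1.cons (by simp) (Nat.lt_succ_of_le hj), by simp; omega,
      fun v hv => (h3 v hv).trans (deg_le_deg_cons _ _ _), ?_, ?_⟩
    · rw [deg_cons, if_pos rfl]; omega
    · rw [deg_cons, if_pos rfl]; split_ifs <;> omega
  · refine ⟨h.within.mono (Nat.le_succ _), by rw [h.card]; ring, h.le_deg, by omega, ?_⟩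
    rw [h.within.deg_eq_zero le_rfl]; omega

theorem afterRounds {μ m : ℕ} (hm : m ≤ n) {G : MGraph n}
    (hG : G ∈ (rounds n μ m).support) : AfterRounds μ m G := by
  induction m generalizing G with
  | zero =>
    simp only [rounds, PMF.support_pure, Set.mem_singleton_iff] at hG
    subst hG
    exact ⟨by simp [Within], by simp, by simp, by simp⟩
  | succ m ih =>
    rw [rounds_succ hm, PMF.mem_support_bind_iff] at hG
    obtain ⟨G₀, hG₀, hG⟩ := hG
    exact (ih (Nat.le_of_succ_le hm) hG₀).attachMany hG

/-- This discards all rounds after the one in which an event was settled. -/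
theorem Decreasing.expect_rounds_le {f : MGraph n → ℝ≥0∞} (hf : Decreasing f) {μ m m' : ℕ}
    (hm : m ≤ m') (hm' : m' ≤ n) : expect (rounds n μ m') f ≤ expect (rounds n μ m) f := by
  induction m', hm using Nat.le_induction with
  | base => exact le_rfl
  | succ m' _ ih =>
    rw [rounds_succ hm', expect_bind]
    exact (expect_mono fun G _ => hf.expect_attachMany _ _ G).trans (ih (Nat.le_of_succ_le hm'))

end Attachment

/-! ### Exponential moments of the degrees -/

section Moments

/-- The expected factor by which a degree grows while the number of edges grows from `0` to `e`. -/
noncomputable def growth (e : ℕ) : ℝ := ∏ t ∈ Finset.range e, ((2 * t + 2 : ℝ) / (2 * t + 1))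

theorem growth_succ (e : ℕ) : growth (e + 1) = growth e * ((2 * e + 2) / (2 * e + 1)) := by
  rw [growth, Finset.prod_range_succ, growth]

theorem growth_pos (e : ℕ) : 0 < growth e := Finset.prod_pos fun _ _ => by positivity

/-- Telescoping, since `(2e + 1)(2e + 3) ≤ (2e + 2)²`; the upper bound below uses `4e(e + 1) ≤ (2e +
1)²` instead. -/
theorem growth_sq_ge (e : ℕ) : 2 * (e : ℝ) + 1 ≤ growth e ^ 2 := by
  induction e with
  | zero => simp [growth]
  | succ e ih =>
    rw [growth_succ, mul_pow, div_pow, ← mul_div_assoc, le_div_iff₀ (by positivity)]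
    push_cast
    have : (0 : ℝ) ≤ e := e.cast_nonneg
    calc (2 * ((e : ℝ) + 1) + 1) * (2 * e + 1) ^ 2
        = (2 * e + 1) * ((2 * e + 1) * (2 * e + 3)) := by ring
      _ ≤ (2 * e + 1) * (2 * e + 2) ^ 2 := by gcongr; nlinarith
      _ ≤ _ := by gcongr

theorem growth_sq_le {e : ℕ} (he : 1 ≤ e) : growth e ^ 2 ≤ 4 * e := by
  induction e, he using Nat.le_induction with
  | base => simp [growth]; norm_num
  | succ e _ ih =>
    rw [growth_succ, mul_pow, div_pow, ← mul_div_assoc, div_le_iff₀ (by positivity)]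
    push_cast
    have : (0 : ℝ) ≤ e := e.cast_nonneg
    calc growth e ^ 2 * (2 * (e : ℝ) + 2) ^ 2 ≤ 4 * (e : ℝ) * (2 * (e : ℝ) + 2) ^ 2 := by
          gcongr
      _ = 4 * ((e : ℝ) + 1) * (4 * (e : ℝ) * ((e : ℝ) + 1)) := by ring
      _ ≤ _ := by gcongr; nlinarith

/-- With `b = x / (2e + 1)` the left side is `(1 - x)⁻¹ ^ d * (1 + d b / (1 - x))`. Bernoulli's
inequality moves `d` into the exponent, and the two bases then compare because `(1 - x)⁻¹ (1 + b /
(1 - x)) (1 - x - b) = 1 - (b / (1 - x))²`. Both signs of `x` are allowed, so one inequality serves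
both tails. -/
theorem moment_step {x : ℝ} (d e : ℕ) (hy : x * ((2 * e + 2) / (2 * e + 1)) < 1) :
    (d * (1 - x)⁻¹ ^ (d + 1) + (2 * e + 1 - d) * (1 - x)⁻¹ ^ d) / (2 * e + 1) ≤
      (1 - x * ((2 * e + 2) / (2 * e + 1)))⁻¹ ^ d := by
  have he : (0 : ℝ) < 2 * e + 1 := by positivity
  set b := x / (2 * e + 1) with hb
  have hx : x = (2 * e + 1) * b := by rw [hb]; field_simp
  have hxb : x * ((2 * e + 2) / (2 * e + 1)) = x + b := by rw [hb]; field_simp; ring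
  rw [hxb] at hy ⊢
  have ha : 0 < 1 - x := by
    rcases le_or_gt x 0 with h | h
    · linarith
    · have : 0 < b := div_pos h he
      linarith
  have hab : 0 < 1 - (x + b) := by linarith
  have hq : -1 ≤ b * (1 - x)⁻¹ := by
    rw [← div_eq_mul_inv, le_div_iff₀ ha]
    rcases le_or_gt 0 b with h | h
    · linarith
    · have : (0 : ℝ) ≤ e := e.cast_nonneg
      nlinarith
  calc _ = (1 - x)⁻¹ ^ d * (1 + d * (b * (1 - x)⁻¹)) := by
        have hz : x * (1 - x)⁻¹ = (1 - x)⁻¹ - 1 := by field_simp; ring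
        rw [div_eq_iff he.ne', pow_succ]
        linear_combination (-((1 - x)⁻¹ ^ d * d)) * hz + ((1 - x)⁻¹ ^ d * d * (1 - x)⁻¹) * hx
    _ ≤ (1 - x)⁻¹ ^ d * (1 + b * (1 - x)⁻¹) ^ d := by
        gcongr
        exact one_add_mul_le_pow (by linarith) d
    _ = ((1 - x)⁻¹ * (1 + b * (1 - x)⁻¹)) ^ d := by rw [mul_pow]
    _ ≤ _ := by
        have h0 : 0 ≤ 1 + b * (1 - x)⁻¹ := by linarith
        gcongr
        rw [inv_eq_one_div (1 - (x + b)), le_div_iff₀ hab]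
        have : (1 - x)⁻¹ * (1 + b * (1 - x)⁻¹) * (1 - (x + b)) =
            1 - (b * (1 - x)⁻¹) ^ 2 := by field_simp; ring
        rw [this]
        nlinarith [sq_nonneg (b * (1 - x)⁻¹)]

variable {n : ℕ}

/-- The potential of a degree `d` when there are `e` edges. -/
noncomputable def potential (α : ℝ) (e d : ℕ) : ℝ := (1 - α / growth e)⁻¹ ^ d

theorem div_growth_succ (α : ℝ) (e : ℕ) :
    α / growth (e + 1) * ((2 * e + 2) / (2 * e + 1)) = α / growth e := by
  rw [growth_succ]
  have := growth_pos e
  field_simp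

/-- As `growth` increases, the base of the potential stays positive once it is so at the start. -/
theorem div_growth_lt_one {α : ℝ} {e e' : ℕ} (he : e ≤ e') (h : α / growth e < 1) :
    α / growth e' < 1 := by
  induction e', he using Nat.le_induction with
  | base => exact h
  | succ e' _ ih =>
    rw [← div_growth_succ] at ih
    rcases le_or_gt (α / growth (e' + 1)) 0 with h0 | h0
    · linarith
    · refine lt_of_le_of_lt (le_mul_of_one_le_right h0.le ?_) ih
      rw [one_le_div (by positivity)]; linarith

theorem potential_nonneg {α : ℝ} {e : ℕ} (h : α / growth e < 1) (d : ℕ) :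
    0 ≤ potential α e d := by
  have : 0 ≤ (1 - α / growth e)⁻¹ := by rw [inv_nonneg]; linarith
  exact pow_nonneg this d

/-- For `v < i` the degree of `v` changes only if the new edge goes to `v` itself, which has weight
`G.deg v`; all other ends leave it alone. This is the situation of `moment_step` with `x = α /
growth (e + 1)`. -/
theorem expect_attach_potential {α : ℝ} {G : MGraph n} {i v : Fin n} (hv : v < i)
    (hG : Within (i.val + 1) G) (hα : α / growth (Multiset.card G) < 1) :
    expect (attach G i) (fun j => ENNReal.ofReal
      (potential α (Multiset.card G + 1) (MGraph.deg (s(i, j) ::ₘ G) v))) ≤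
      ENNReal.ofReal (potential α (Multiset.card G) (G.deg v)) := by
  set e := Multiset.card G
  rw [expect_attach hG _ fun j => potential_nonneg (div_growth_lt_one (Nat.le_succ e) hα) _]
  apply ENNReal.ofReal_le_ofReal
  have key := moment_step (x := α / growth (e + 1)) (G.deg v) e (by rwa [div_growth_succ])
  rw [div_growth_succ] at key
  refine le_trans (le_of_eq ?_) key
  congr 1
  have hw : (attachWeight G i v : ℝ) = G.deg v := by simp [attachWeight, hv]
  have hsum := sum_attachWeight_of_within hG
  rw [← Finset.add_sum_erase _ _ (Finset.mem_univ v), hw] at hsum ⊢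
  have hother : ∀ j ∈ Finset.univ.erase v, (attachWeight G i j : ℝ) *
      potential α (e + 1) (MGraph.deg (s(i, j) ::ₘ G) v) =
      attachWeight G i j * (1 - α / growth (e + 1))⁻¹ ^ G.deg v := by
    intro j hj
    rw [deg_cons, if_neg hv.ne, if_neg (Finset.ne_of_mem_erase hj).symm]
    rfl
  rw [Finset.sum_congr rfl hother, ← Finset.sum_mul, ← eq_sub_iff_add_eq'.2 hsum]
  rw [deg_cons, if_neg hv.ne, if_pos rfl]
  simp [potential]

theorem expect_attachMany_potential {α : ℝ} {i v : Fin n} (hv : v < i) (k : ℕ) {G : MGraph n}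
    (hG : Within (i.val + 1) G) (hα : α / growth (Multiset.card G) < 1) :
    expect (attachMany i k G)
      (fun G' => ENNReal.ofReal (potential α (Multiset.card G + k) (G'.deg v))) ≤
      ENNReal.ofReal (potential α (Multiset.card G) (G.deg v)) := by
  induction k generalizing G with
  | zero => simp [attachMany, expect_pure]
  | succ k ih =>
    rw [attachMany, expect_bind]
    refine le_trans (expect_mono fun j hj => ?_) (expect_attach_potential hv hG hα)
    have := ih (G := s(i, j) ::ₘ G)
      (hG.cons (by simp) (Nat.lt_succ_of_le (mem_support_attach hj)))
      (div_growth_lt_one (by simp) hα)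
    rw [Multiset.card_cons] at this
    rwa [add_comm k 1, ← add_assoc]

theorem expect_rounds_potential {α : ℝ} {μ m : ℕ} {v : Fin n} (hvm : v.val + 1 ≤ m) (hm : m ≤ n)
    (hα : α / growth (μ * (v.val + 1)) < 1) {B : ℝ}
    (hB : ∀ d, μ ≤ d → d ≤ 2 * μ → potential α (μ * (v.val + 1)) d ≤ B) :
    expect (rounds n μ m) (fun G => ENNReal.ofReal (potential α (μ * m) (G.deg v))) ≤
      ENNReal.ofReal B := by
  induction m, hvm using Nat.le_induction with
  | base =>
    refine expect_le fun G hG => ENNReal.ofReal_le_ofReal ?_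
    have := afterRounds hm hG
    exact hB _ (this.le_deg v (Nat.lt_succ_self _)) (this.deg_le v rfl)
  | succ m hvm ih =>
    rw [rounds_succ hm, expect_bind]
    refine le_trans (expect_mono fun G hG => ?_) (ih (Nat.le_of_succ_le hm))
    have hG' := afterRounds (Nat.le_of_succ_le hm) hG
    have := expect_attachMany_potential (α := α) (i := ⟨m, hm⟩) (v := v) hvm μ (G := G)
      (hG'.within.mono (Nat.le_succ m))
      (by rw [hG'.card]; exact div_growth_lt_one (Nat.mul_le_mul_left _ hvm) hα)
    rwa [hG'.card] at this

theorem exp_le_inv {x : ℝ} (hx : x < 1) : Real.exp x ≤ (1 - x)⁻¹ := by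
  rw [← neg_neg x, Real.exp_neg]
  have := Real.add_one_le_exp (-x)
  refine inv_anti₀ (by linarith) (by linarith)

theorem exp_le_potential {α : ℝ} {e : ℕ} (h : α / growth e < 1) (d : ℕ) :
    Real.exp (d * (α / growth e)) ≤ potential α e d := by
  rw [Real.exp_nat_mul]
  exact pow_le_pow_left₀ (Real.exp_pos _).le (exp_le_inv h) d

/-- The expected factor by which the degree of `v` grows after the round of `v`. -/
noncomputable def gain (n μ : ℕ) (v : Fin n) : ℝ := growth (μ * n) / growth (μ * (v.val + 1))

theorem gain_pos (μ : ℕ) (v : Fin n) : 0 < gain n μ v := div_pos (growth_pos _) (growth_pos _)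

/-- Markov's inequality with `α` half of the growth at the end of the round of `v`. The potential
then starts at most at `2 ^ (2μ)`, as the degree is at most `2μ`, while the event forces it to at
least `exp (3μ)`; and `4 ≤ e²`. -/
theorem expect_large_deg {μ : ℕ} (v : Fin n) :
    expect (rounds n μ n) (fun G => if 6 * μ * gain n μ v < G.deg v then 1 else 0) ≤
      ENNReal.ofReal (Real.exp (-μ)) := by
  set t := growth (μ * (v.val + 1)) with ht
  have htpos : 0 < t := growth_pos _
  have hα : t / 2 / growth (μ * (v.val + 1)) = 1 / 2 := by rw [← ht]; field_simp
  have hlt : t / 2 / growth (μ * (v.val + 1)) < 1 := by rw [hα]; norm_num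
  have hend : t / 2 / growth (μ * n) = 1 / (2 * gain n μ v) := by
    have := growth_pos (μ * n)
    rw [gain, ← ht]; field_simp
  have hlt' := div_growth_lt_one (Nat.mul_le_mul_left μ (Nat.succ_le_of_lt v.isLt)) hlt
  have main := expect_rounds_potential (n := n) (μ := μ) (Nat.succ_le_of_lt v.isLt) le_rfl hlt
    (B := 4 ^ μ) (by
      intro d _ hd
      rw [potential, hα]
      calc _ = (2 : ℝ) ^ d := by norm_num
        _ ≤ 2 ^ (2 * μ) := by gcongr; norm_num
        _ = 4 ^ μ := by rw [pow_mul]; norm_num)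
  calc _ ≤ expect (rounds n μ n) (fun G => ENNReal.ofReal (potential (t / 2) (μ * n) (G.deg v)) *
          ENNReal.ofReal (Real.exp (-(3 * μ)))) := by
        refine expect_mono fun G _ => ?_
        split_ifs with h
        · rw [← ENNReal.ofReal_mul (potential_nonneg hlt' _), ← ENNReal.ofReal_one]
          apply ENNReal.ofReal_le_ofReal
          calc 1 = Real.exp (3 * μ) * Real.exp (-(3 * μ)) := by rw [← Real.exp_add]; simp
            _ ≤ _ := by
              gcongr
              refine le_trans ?_ (exp_le_potential hlt' _)
              rw [hend, Real.exp_le_exp]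
              have := gain_pos μ v
              rw [mul_one_div, le_div_iff₀ (by positivity)]
              linarith
        · exact zero_le
    _ ≤ ENNReal.ofReal (4 ^ μ) * ENNReal.ofReal (Real.exp (-(3 * μ))) := by
        rw [expect_mul_const]; gcongr
    _ ≤ _ := by
        rw [← ENNReal.ofReal_mul (by positivity)]
        apply ENNReal.ofReal_le_ofReal
        have h4 : (4 : ℝ) ≤ Real.exp 2 := by
          have := Real.add_one_le_exp (1 : ℝ)
          have h2 : Real.exp 2 = Real.exp 1 * Real.exp 1 := by rw [← Real.exp_add]; norm_num
          nlinarith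
        calc (4 : ℝ) ^ μ * Real.exp (-(3 * μ)) ≤ Real.exp 2 ^ μ * Real.exp (-(3 * μ)) := by gcongr
          _ = _ := by rw [← Real.exp_nat_mul, ← Real.exp_add]; congr 1; ring

/-- The same with negative `α`, chosen so that the base at the start is `1/2`. The starting degree
is at least `μ`, the event forces the potential to at least `exp (-μ/3)`, and `1/2 ≤ exp (-1/2)`. -/
theorem expect_small_deg {μ : ℕ} (v : Fin n) :
    expect (rounds n μ n) (fun G => if (G.deg v : ℝ) < μ / 3 * gain n μ v then 1 else 0) ≤
      ENNReal.ofReal (Real.exp (-(μ / 6))) := by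
  set t := growth (μ * (v.val + 1)) with ht
  have htpos : 0 < t := growth_pos _
  have hα : -t / growth (μ * (v.val + 1)) = -1 := by rw [← ht]; field_simp
  have hlt : -t / growth (μ * (v.val + 1)) < 1 := by rw [hα]; norm_num
  have hend : -t / growth (μ * n) = -(1 / gain n μ v) := by
    have := growth_pos (μ * n)
    rw [gain, ← ht]; field_simp
  have hlt' := div_growth_lt_one (Nat.mul_le_mul_left μ (Nat.succ_le_of_lt v.isLt)) hlt
  have main := expect_rounds_potential (n := n) (μ := μ) (Nat.succ_le_of_lt v.isLt) le_rfl hlt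
    (B := (1 / 2) ^ μ) (by
      intro d hd _
      rw [potential, hα]
      calc _ = (1 / 2 : ℝ) ^ d := by norm_num
        _ ≤ (1 / 2) ^ μ := pow_le_pow_of_le_one (by norm_num) (by norm_num) hd)
  calc _ ≤ expect (rounds n μ n) (fun G => ENNReal.ofReal (potential (-t) (μ * n) (G.deg v)) *
          ENNReal.ofReal (Real.exp (μ / 3))) := by
        refine expect_mono fun G _ => ?_
        split_ifs with h
        · rw [← ENNReal.ofReal_mul (potential_nonneg hlt' _), ← ENNReal.ofReal_one]
          apply ENNReal.ofReal_le_ofReal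
          calc 1 = Real.exp (-(μ / 3)) * Real.exp (μ / 3) := by rw [← Real.exp_add]; simp
            _ ≤ _ := by
              gcongr
              refine le_trans ?_ (exp_le_potential hlt' _)
              rw [hend, Real.exp_le_exp]
              have := gain_pos μ v
              rw [mul_neg, neg_le_neg_iff, mul_one_div, div_le_iff₀ (by positivity)]
              linarith
        · exact zero_le
    _ ≤ ENNReal.ofReal ((1 / 2) ^ μ) * ENNReal.ofReal (Real.exp (μ / 3)) := by
        rw [expect_mul_const]; gcongr
    _ ≤ _ := by
        rw [← ENNReal.ofReal_mul (by positivity)]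
        apply ENNReal.ofReal_le_ofReal
        have h2 : (1 / 2 : ℝ) ≤ Real.exp (-(1 / 2)) := by
          have := Real.add_one_le_exp (-(1 / 2) : ℝ)
          linarith
        calc (1 / 2 : ℝ) ^ μ * Real.exp (μ / 3) ≤ Real.exp (-(1 / 2)) ^ μ * Real.exp (μ / 3) := by
              gcongr
          _ = _ := by rw [← Real.exp_nat_mul, ← Real.exp_add]; congr 1; ring

end Moments

/-! ### Neighbours among the earlier vertices -/

section Neighbours

variable {n : ℕ}

open Classical in
/-- The indicator of the event that `i` has no neighbour in `A`. -/
noncomputable def misses (i : Fin n) (A : Finset (Fin n)) (G : MGraph n) : ℝ≥0∞ :=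
  if ∃ j ∈ A, s(i, j) ∈ G then 0 else 1

theorem misses_decreasing (i : Fin n) (A : Finset (Fin n)) : Decreasing (misses i A) := by
  intro e G
  unfold misses
  split_ifs with h1 h2 h2
  · exact le_rfl
  · exact zero_le
  · obtain ⟨j, hj, h⟩ := h2
    exact absurd ⟨j, hj, Multiset.mem_cons_of_mem h⟩ h1
  · exact le_rfl

/-- The set `A` has weight at least `μ |A|` out of a total of at most `2μ(i + 1)`, whatever the
earlier edges of the round did. So each edge misses `A` with conditional probability at most `1 -
|A| / (2(i + 1))`. -/
theorem expect_attachMany_misses {μ : ℕ} (hμ : 1 ≤ μ) {i : Fin n} {A : Finset (Fin n)}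
    (hA : ∀ j ∈ A, j < i) (k : ℕ) {G : MGraph n} (hG : Within (i.val + 1) G)
    (hdeg : ∀ j ∈ A, μ ≤ G.deg j) (hcard : Multiset.card G + k ≤ μ * (i.val + 1)) :
    expect (attachMany i k G) (misses i A) ≤
      ENNReal.ofReal (Real.exp (-(A.card / (2 * (i.val + 1)))) ^ k) := by
  induction k generalizing G with
  | zero =>
    simp only [attachMany, expect_pure, pow_zero, ENNReal.ofReal_one, misses]
    split_ifs <;> simp
  | succ k ih =>
    set r := Real.exp (-(A.card / (2 * (i.val + 1)))) with hr
    have hr0 : 0 < r := Real.exp_pos _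
    rw [attachMany, expect_bind]
    calc _ ≤ expect (attach G i) (fun j => ENNReal.ofReal (if j ∈ A then 0 else r ^ k)) := by
          refine expect_mono fun j hj => ?_
          -- An edge into `A` makes the indicator zero for good; otherwise induction applies to the
          -- remaining `k` edges.
          split_ifs with hjA
          · refine ((misses_decreasing i A).expect_attachMany i k _).trans ?_
            rw [misses, if_pos ⟨j, hjA, Multiset.mem_cons_self _ _⟩]
            exact zero_le
          · refine ih (hG.cons (by simp) (Nat.lt_succ_of_le (mem_support_attach hj))) ?_ ?_
            · exact fun j hj => (hdeg j hj).trans (deg_le_deg_cons _ _ _)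
            · simp; omega
      _ ≤ _ := by
        rw [expect_attach hG _ fun j => by split_ifs <;> positivity]
        apply ENNReal.ofReal_le_ofReal
        have hsum := sum_attachWeight_of_within hG
        have hw : (μ : ℝ) * A.card ≤ ∑ j ∈ A, (attachWeight G i j : ℝ) := by
          rw [mul_comm, ← nsmul_eq_mul]
          refine Finset.card_nsmul_le_sum _ _ _ fun j hj => ?_
          simp only [attachWeight, hA j hj, if_true]
          exact_mod_cast hdeg j hj
        have hrest : ∑ j, (attachWeight G i j : ℝ) * (if j ∈ A then 0 else r ^ k) =
            (∑ j, (attachWeight G i j : ℝ) - ∑ j ∈ A, (attachWeight G i j : ℝ)) * r ^ k := by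
          have : ∑ j ∈ A, (attachWeight G i j : ℝ) =
              ∑ j, if j ∈ A then (attachWeight G i j : ℝ) else 0 := by
            simp [Finset.sum_ite_mem]
          rw [this, ← Finset.sum_sub_distrib, Finset.sum_mul]
          refine Finset.sum_congr rfl fun j _ => ?_
          split_ifs <;> simp
        rw [hrest, hsum, pow_succ', div_le_iff₀ (by positivity)]
        have hexp : 1 - (A.card : ℝ) / (2 * (i.val + 1)) ≤ r := by
          have := Real.add_one_le_exp (-((A.card : ℝ) / (2 * (i.val + 1))))
          linarith
        have hS : 2 * (Multiset.card G : ℝ) + 1 ≤ 2 * (μ * (i.val + 1)) := by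
          have : (Multiset.card G : ℝ) + (k + 1) ≤ μ * (i.val + 1) := by exact_mod_cast hcard
          have : (0 : ℝ) ≤ k := k.cast_nonneg
          linarith
        have hfrac : (A.card : ℝ) / (2 * (i.val + 1)) * (2 * Multiset.card G + 1) ≤
            μ * A.card := by
          calc _ ≤ (A.card : ℝ) / (2 * (i.val + 1)) * (2 * (μ * (i.val + 1))) := by gcongr
            _ = _ := by field_simp
        calc _ ≤ ((1 - (A.card : ℝ) / (2 * (i.val + 1))) * (2 * Multiset.card G + 1)) * r ^ k := by
              gcongr
              linarith
          _ ≤ (r * (2 * Multiset.card G + 1)) * r ^ k := by gcongr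
          _ = _ := by ring

theorem expect_misses {μ : ℕ} (hμ : 1 ≤ μ) {i : Fin n} {A : Finset (Fin n)}
    (hA : ∀ j ∈ A, j < i) {q : ℝ} (hq : q ≤ A.card / (2 * (i.val + 1))) :
    expect (rounds n μ n) (misses i A) ≤ ENNReal.ofReal (Real.exp (-(μ * q))) := by
  refine ((misses_decreasing i A).expect_rounds_le (Nat.succ_le_of_lt i.isLt) le_rfl).trans ?_
  rw [rounds_succ i.isLt, expect_bind]
  refine expect_le fun G hG => ?_
  have hG' := afterRounds i.isLt.le hG
  refine (expect_attachMany_misses hμ hA μ (hG'.within.mono (Nat.le_succ _))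
    (fun j hj => hG'.le_deg j (hA j hj)) (by rw [hG'.card]; exact le_of_eq (by ring))).trans ?_
  apply ENNReal.ofReal_le_ofReal
  rw [← Real.exp_nat_mul, Real.exp_le_exp]
  nlinarith [(Nat.cast_nonneg μ : (0 : ℝ) ≤ μ)]

end Neighbours

/-! ### The structure of the spanner -/

section Spanner

variable {n : ℕ} {G : MGraph n}

theorem IsTopNbr.deg_le {u v w : Fin n} (h : IsTopNbr G u v) (hw : w ≠ u) (huw : s(u, w) ∈ G) :
    G.deg w ≤ G.deg v := by
  rcases h.2.2 w hw huw with h | h <;> omega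

theorem IsTopNbr.unique {u v w : Fin n} (hv : IsTopNbr G u v) (hw : IsTopNbr G u w) : v = w := by
  rcases hv.2.2 w hw.1 hw.2.1 with h | h <;> rcases hw.2.2 v hv.1 hv.2.1 with h' | h' <;> omega

theorem exists_maximal (s : Finset (Fin n)) (hs : s.Nonempty) :
    ∃ v ∈ s, ∀ w ∈ s, G.deg w < G.deg v ∨ (G.deg w = G.deg v ∧ w ≤ v) := by
  obtain ⟨v, hv, h⟩ := s.exists_max_image (fun w => toLex (G.deg w, w)) hs
  exact ⟨v, hv, fun w hw => Prod.Lex.toLex_le_toLex.1 (h w hw)⟩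

theorem exists_isTopNbr {u : Fin n} (h : ∃ w, w ≠ u ∧ s(u, w) ∈ G) : ∃ v, IsTopNbr G u v := by
  classical
  obtain ⟨w, hw⟩ := h
  obtain ⟨v, hv, hmax⟩ := exists_maximal (G := G)
    (Finset.univ.filter fun w => w ≠ u ∧ s(u, w) ∈ G) ⟨w, by simpa using hw⟩
  simp only [Finset.mem_filter, Finset.mem_univ, true_and] at hv hmax
  exact ⟨v, hv.1, hv.2, fun w h1 h2 => hmax w ⟨h1, h2⟩⟩

theorem topSpanner_subset : topSpanner G ⊆ G.edges := by
  rintro ⟨e, i⟩ ⟨rfl, u, v, rfl, h⟩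
  exact ⟨le_rfl, Multiset.one_le_count_iff_mem.2 h.2.1⟩

theorem IsTopNbr.adj {u v : Fin n} (h : IsTopNbr G u v) :
    (underlying (topSpanner G)).Adj u v := by
  rw [underlying, SimpleGraph.fromEdgeSet_adj]
  exact ⟨⟨1, rfl, u, v, rfl, h⟩, h.1.symm⟩

theorem exists_walk_iterate {f : Fin n → Fin n} (hf : ∀ u, IsTopNbr G u (f u)) (k : ℕ)
    (u : Fin n) : ∃ p : (underlying (topSpanner G)).Walk u (f^[k] u), p.length = k := by
  induction k generalizing u with
  | zero => exact ⟨.nil, rfl⟩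
  | succ k ih =>
    obtain ⟨p, hp⟩ := ih (f u)
    exact ⟨.cons (hf u).adj p, by simp [hp]⟩

/-- Any two vertices are joined through the root `m` within `2L` steps, and distinct vertices have
distance at least one in `G`. -/
theorem isSpanner_of_iterate {f : Fin n → Fin n} (hf : ∀ u, IsTopNbr G u (f u)) {m : Fin n}
    {L : ℕ} (h : ∀ u, ∃ k ≤ L, f^[k] u = m) : IsSpanner G (topSpanner G) (2 * L) := by
  have hwalk : ∀ u, ∃ p : (underlying (topSpanner G)).Walk u m, p.length ≤ L := by
    intro u
    obtain ⟨k, hk, rfl⟩ := h u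
    obtain ⟨p, hp⟩ := exists_walk_iterate hf k u
    exact ⟨p, hp.trans_le hk⟩
  refine ⟨topSpanner_subset, fun u v huv => ?_⟩
  obtain ⟨p, hp⟩ := hwalk u
  obtain ⟨q, hq⟩ := hwalk v
  refine ⟨⟨p.append q.reverse⟩, ?_⟩
  rcases eq_or_ne u v with rfl | hne
  · simp
  · have h1 : (underlying (topSpanner G)).dist u v ≤ 2 * L := by
      refine (SimpleGraph.dist_le (p.append q.reverse)).trans ?_
      rw [SimpleGraph.Walk.length_append, SimpleGraph.Walk.length_reverse]
      omega
    have h2 : 1 ≤ (underlying G.edges).dist u v := huv.pos_dist_of_ne hne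
    have h1' : ((underlying (topSpanner G)).dist u v : ℝ) ≤ 2 * L := by exact_mod_cast h1
    have h2' : (1 : ℝ) ≤ (underlying G.edges).dist u v := by exact_mod_cast h2
    refine h1'.trans (le_mul_of_one_le_right (by positivity) h2')

/-- Each vertex other than the root contributes its own edge: if two of them chose the same edge,
they would form a 2-cycle of `f` and never reach `m`. The edge chosen by `m` is the one chosen by `f
m`. -/
theorem ncard_topSpanner_of_iterate {f : Fin n → Fin n} (hf : ∀ u, IsTopNbr G u (f u)) {m : Fin n}
    (hm : f (f m) = m) (h : ∀ u, ∃ k, f^[k] u = m) : (topSpanner G).ncard = n - 1 := by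
  have himage : topSpanner G = (fun u => (s(u, f u), 1)) '' {m}ᶜ := by
    ext ⟨e, i⟩
    constructor
    · rintro ⟨rfl, u, v, rfl, huv⟩
      obtain rfl := (hf u).unique huv
      by_cases hu : u = m
      · subst hu
        exact ⟨f u, (hf u).1, by simp [hm, Sym2.eq_swap]⟩
      · exact ⟨u, hu, rfl⟩
    · rintro ⟨u, _, h⟩
      obtain ⟨rfl, rfl⟩ := Prod.mk.inj h
      exact ⟨rfl, u, f u, rfl, hf u⟩
  rw [himage, Set.InjOn.ncard_image, Set.ncard_compl]
  · simp
  · intro u hu v hv huv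
    by_contra hne
    obtain ⟨h1, h2⟩ : u = f v ∧ f u = v := by
      rcases Sym2.eq_iff.1 (Prod.mk.inj huv).1 with h | h
      · exact absurd h.1 hne
      · exact h
    have hstay : ∀ k, f^[k] u = u ∨ f^[k] u = v := by
      intro k
      induction k with
      | zero => exact .inl rfl
      | succ k ih =>
        rw [Function.iterate_succ_apply']
        rcases ih with ih | ih <;> rw [ih]
        · exact .inr h2
        · exact .inl h1.symm
    obtain ⟨k, hk⟩ := h u
    rcases hstay k with h' | h'
    · exact hu (h' ▸ hk)
    · exact hv (h' ▸ hk)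

/-- If some vertices form a clique, and all the others have a neighbour of at least twice their
degree, then the spanner is a tree of small depth. -/
theorem isSpanner_of_core {core : Fin n → Prop} {L : ℕ} [Nonempty (Fin n)]
    (hnbr : ∀ u, ∃ w, w ≠ u ∧ s(u, w) ∈ G)
    (hcore : ∀ u v, core u → core v → u ≠ v → s(u, v) ∈ G)
    (hgrow : ∀ u, ¬ core u → ∃ w, w ≠ u ∧ s(u, w) ∈ G ∧ 2 * G.deg u ≤ G.deg w)
    (hdeg : ∀ u w, G.deg w < 2 ^ L * G.deg u) :
    IsSpanner G (topSpanner G) (2 * L) ∧ (topSpanner G).ncard = n - 1 := by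
  choose f hf using fun u => exists_isTopNbr (hnbr u)
  obtain ⟨m, -, hm⟩ := exists_maximal (G := G) Finset.univ Finset.univ_nonempty
  have hfm : ∀ u, u ≠ m → s(u, m) ∈ G → f u = m := fun u hne hmem =>
    (hf u).unique ⟨hne.symm, hmem, fun w _ _ => hm w (Finset.mem_univ w)⟩
  -- Outside the core the maximal degree could be doubled; `hdeg m m` excludes degree zero.
  have hmcore : core m := by
    by_contra h
    obtain ⟨w, -, -, hw⟩ := hgrow m h
    have := hdeg m m
    have : G.deg m ≠ 0 := by rintro h0; simp [h0] at this
    rcases hm w (Finset.mem_univ w) with h | h <;> omega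
  -- The exponent `k` bounds the number of doublings left before the degree would exceed the
  -- maximum.
  have hiter : ∀ k u, G.deg m < 2 ^ k * G.deg u → ∃ j ≤ k, f^[j] u = m := by
    intro k
    induction k with
    | zero =>
      intro u hu
      rcases hm u (Finset.mem_univ u) with h | h <;> omega
    | succ k ih =>
      intro u hu
      by_cases hum : u = m
      · exact ⟨0, Nat.zero_le _, hum⟩
      by_cases hc : core u
      · exact ⟨1, by omega, hfm u hum (hcore u m hc hmcore hum)⟩
      · obtain ⟨w, hw1, hw2, hw3⟩ := hgrow u hc
        have h1 := hw3.trans ((hf u).deg_le hw1 hw2)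
        obtain ⟨j, hj, h⟩ := ih (f u) <| hu.trans_le <| by
          rw [pow_succ, mul_assoc]
          exact Nat.mul_le_mul_left _ h1
        exact ⟨j + 1, by omega, h⟩
  have hiterL := fun u => hiter L u (hdeg u m)
  refine ⟨isSpanner_of_iterate hf hiterL, ncard_topSpanner_of_iterate (m := m) hf ?_ fun u => ?_⟩
  · exact hfm _ (hf m).1 (by rw [Sym2.eq_swap]; exact (hf m).2.1)
  · obtain ⟨k, -, h⟩ := hiterL u
    exact ⟨k, h⟩

end Spanner

/-! ### Averages over the queries -/

section Queries

variable {n : ℕ}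

theorem count_le_ends (G : MGraph n) (u v : Fin n) : G.count s(u, v) ≤ G.ends u v := by
  unfold MGraph.ends
  split_ifs with h
  · subst h; omega
  · exact le_rfl

theorem ends_le_two_mul_count (G : MGraph n) (u v : Fin n) :
    G.ends u v ≤ 2 * G.count s(u, v) := by
  unfold MGraph.ends
  split_ifs with h
  · subst h; exact le_rfl
  · omega

theorem sum_queries (G : MGraph n) (g : Fin n → Fin n → ℕ) :
    ∑ q ∈ queries G, g q.1 q.2.1 = ∑ u, ∑ v, G.count s(u, v) * g u v := by
  rw [queries, Finset.sum_filter, Finset.sum_product]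
  refine Finset.sum_congr rfl fun u _ => ?_
  rw [Finset.sum_product]
  refine Finset.sum_congr rfl fun v _ => ?_
  rw [← Finset.sum_filter]
  simp only [Finset.sum_const, smul_eq_mul]
  congr 1
  have : (Finset.range (G.card + 1)).filter (fun i => 1 ≤ i ∧ i ≤ G.count s(u, v)) =
      Finset.Icc 1 (G.count s(u, v)) := by
    ext i
    have := Multiset.count_le_card s(u, v) G
    simp only [Finset.mem_filter, Finset.mem_range, Finset.mem_Icc]
    omega
  simp [this]

/-- An edge with distinct ends can be asked for in two orientations, a self-loop in only one. -/
theorem card_le_card_queries (G : MGraph n) : Multiset.card G ≤ (queries G).card := by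
  have h1 := sum_queries G fun _ _ => 1
  simp only [Finset.sum_const, smul_eq_mul, mul_one] at h1
  have h2 : 2 * Multiset.card G ≤ 2 * ∑ u, ∑ v, G.count s(u, v) := by
    rw [← sum_deg, Finset.mul_sum]
    refine Finset.sum_le_sum fun u _ => ?_
    rw [Finset.mul_sum]
    exact Finset.sum_le_sum fun v _ => ends_le_two_mul_count G u v
  omega

/-- By symmetry both summands contribute equally, and at most `G.deg u` admissible queries have
first end `u`. -/
theorem sum_queries_deg_le (G : MGraph n) :
    ∑ q ∈ queries G, (G.deg q.1 + G.deg q.2.1) ≤ 2 * ∑ u, G.deg u ^ 2 := by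
  have key : ∑ u, ∑ v, G.count s(u, v) * G.deg u ≤ ∑ u, G.deg u ^ 2 := by
    refine Finset.sum_le_sum fun u _ => ?_
    rw [← Finset.sum_mul, sq]
    exact Nat.mul_le_mul_right _ (Finset.sum_le_sum fun v _ => count_le_ends G u v)
  rw [sum_queries G fun u v => G.deg u + G.deg v]
  simp only [mul_add, Finset.sum_add_distrib]
  have hswap : ∑ u, ∑ v, G.count s(u, v) * G.deg v = ∑ u, ∑ v, G.count s(u, v) * G.deg u := by
    rw [Finset.sum_comm]
    simp only [Sym2.eq_swap]
  omega

theorem avgTime_le {G : MGraph n} {T : Query n → ℕ} {C : ℝ} (hC : 0 ≤ C)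
    (hT : ∀ q ∈ queries G, (T q : ℝ) ≤ C * ((G.deg q.1 : ℝ) + (G.deg q.2.1 : ℝ)))
    (hG : 0 < Multiset.card G) :
    avgTime G T ≤ C * (2 * ∑ u, (G.deg u : ℝ) ^ 2) / Multiset.card G := by
  unfold avgTime
  have hG' : (0 : ℝ) < Multiset.card G := by exact_mod_cast hG
  refine div_le_div₀ (by positivity) ?_ hG' (by exact_mod_cast card_le_card_queries G)
  refine (Finset.sum_le_sum hT).trans ?_
  rw [← Finset.mul_sum]
  gcongr
  exact_mod_cast sum_queries_deg_le G

end Queries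

/-! ### Relabelling -/

section Relabelling

variable {n : ℕ}

theorem mem_map_relabel (G : MGraph n) (σ : Equiv.Perm (Fin n)) (u v : Fin n) :
    s(σ u, σ v) ∈ G.map (Sym2.map σ) ↔ s(u, v) ∈ G := by
  rw [← Sym2.map_mk, Multiset.mem_map_of_injective (Sym2.map.injective σ.injective)]

theorem deg_map_relabel (G : MGraph n) (σ : Equiv.Perm (Fin n)) (v : Fin n) :
    MGraph.deg (G.map (Sym2.map σ)) (σ v) = G.deg v := by
  unfold MGraph.deg
  rw [← Equiv.sum_comp σ]
  refine Finset.sum_congr rfl fun u _ => ?_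
  simp only [MGraph.ends, σ.injective.eq_iff]
  have := fun u => Multiset.count_map_eq_count' _ G (Sym2.map.injective σ.injective) s(v, u)
  simp only [Sym2.map_mk] at this
  rw [this, this]

end Relabelling

/-! ### The program -/

section Straight

variable {n : ℕ} {G : MGraph n}

/-- Programs without loops. -/
def Prog.Straight : Prog → Prop
  | .seq P Q => P.Straight ∧ Q.Straight
  | .ifLt _ _ P Q => P.Straight ∧ Q.Straight
  | .whileLt _ _ _ => False
  | _ => True

/-- A bound on the running time of a program without loops. -/
def Prog.size : Prog → ℕ
  | .seq P Q => P.size + Q.size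
  | .ifLt _ _ P Q => P.size + Q.size + 1
  | _ => 1

/-- The effect of a program without loops. -/
def Prog.run (A : AdjLists G) : Prog → (ℕ → ℕ) → ℕ → ℕ
  | .const x c, s => Function.update s x c
  | .copy x y, s => Function.update s x (s y)
  | .succ x, s => Function.update s x (s x + 1)
  | .deg x y, s => Function.update s x (degProbe G (s y))
  | .nbr x y z, s => Function.update s x (nbrProbe A (s y) (s z))
  | .edge x y z, s => Function.update s x (existsProbe G (s y) (s z))
  | .seq P Q, s => Q.run A (P.run A s)
  | .ifLt x y P Q, s => fun r => if s x < s y then P.run A s r else Q.run A s r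
  | .whileLt _ _ _, s => s

theorem Prog.Straight.exec (A : AdjLists G) {P : Prog} (h : P.Straight) (s : ℕ → ℕ) :
    ∃ t ≤ P.size, Exec A P s t (P.run A s) := by
  induction P generalizing s with
  | const x c => exact ⟨1, le_rfl, .const x c s⟩
  | copy x y => exact ⟨1, le_rfl, .copy x y s⟩
  | succ x => exact ⟨1, le_rfl, .succ x s⟩
  | deg x y => exact ⟨1, le_rfl, .deg x y s⟩
  | nbr x y z => exact ⟨1, le_rfl, .nbr x y z s⟩
  | edge x y z => exact ⟨1, le_rfl, .edge x y z s⟩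
  | seq P Q hP hQ =>
    obtain ⟨t, ht, h1⟩ := hP h.1 s
    obtain ⟨t', ht', h2⟩ := hQ h.2 (P.run A s)
    exact ⟨t + t', Nat.add_le_add ht ht', .seq h1 h2⟩
  | ifLt x y P Q hP hQ =>
    by_cases hxy : s x < s y
    · obtain ⟨t, ht, h1⟩ := hP h.1 s
      refine ⟨t + 1, by simp only [Prog.size]; omega, ?_⟩
      simp only [Prog.run, if_pos hxy]
      exact .ifTrue hxy h1
    · obtain ⟨t, ht, h1⟩ := hQ h.2 s
      refine ⟨t + 1, by simp only [Prog.size]; omega, ?_⟩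
      simp only [Prog.run, if_neg hxy]
      exact .ifFalse hxy h1
  | whileLt x y P => exact h.elim

end Straight

/-! ### What the probes reveal about the highest-degree neighbour -/

section Probes

variable {n : ℕ} {G : MGraph n}

theorem vertex_ident (v : Fin n) : vertex n (ident v) = some v := by
  simp [vertex, ident, Nat.succ_le_of_lt v.isLt]

theorem degProbe_ident (v : Fin n) : degProbe G (ident v) = G.deg v := by
  simp [degProbe, vertex_ident]

theorem degProbe_zero : degProbe G 0 = 0 := by simp [degProbe, vertex]

theorem ident_inj {v w : Fin n} : ident v = ident w ↔ v = w := by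
  simp [ident, Fin.ext_iff]

theorem ident_lt {v w : Fin n} : ident v < ident w ↔ v < w := by simp [ident]

theorem ends_pos {v u : Fin n} : 0 < G.ends v u ↔ s(v, u) ∈ G := by
  rw [← Multiset.count_pos]
  unfold MGraph.ends
  split_ifs with h
  · subst h; omega
  · rfl

theorem mem_list (A : AdjLists G) {v u : Fin n} : u ∈ A.list v ↔ s(v, u) ∈ G := by
  rw [← List.count_pos_iff, A.count_list, ends_pos]

theorem length_list (A : AdjLists G) (v : Fin n) : (A.list v).length = G.deg v := by
  unfold MGraph.deg
  simp only [← A.count_list]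
  have := Multiset.sum_count_eq_card (s := Finset.univ) (m := (A.list v : Multiset (Fin n)))
    fun a _ => Finset.mem_univ a
  simpa only [Multiset.coe_count, Multiset.coe_card] using this.symm

theorem deg_pos_left {u v : Fin n} (h : s(u, v) ∈ G) : 0 < G.deg u :=
  (ends_pos.2 h).trans_le (Finset.single_le_sum (f := G.ends u) (fun _ _ => Nat.zero_le _)
    (Finset.mem_univ v))

theorem deg_pos_right {u v : Fin n} (h : s(u, v) ∈ G) : 0 < G.deg v :=
  deg_pos_left (u := v) (v := u) (by rwa [Sym2.eq_swap])

/-- The first occurrence of `w` in the list is never suppressed as a repetition. -/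
theorem exists_nbrProbe_eq (A : AdjLists G) {v w : Fin n} (h : s(v, w) ∈ G) :
    ∃ k < G.deg v, nbrProbe A (ident v) (k + 1) = ident w := by
  have hw := (mem_list A).2 h
  have hlt := List.idxOf_lt_length_of_mem hw
  refine ⟨(A.list v).idxOf w, length_list A v ▸ hlt, ?_⟩
  simp only [nbrProbe, vertex_ident, List.getElem?_eq_getElem hlt, List.getElem_idxOf]
  rw [if_neg]
  intro hmem
  exact lt_irrefl _ ((List.mem_take_iff_idxOf_lt hw).1 hmem)

theorem nbrProbe_eq (A : AdjLists G) (v : Fin n) (k : ℕ) :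
    nbrProbe A (ident v) (k + 1) = 0 ∨
      ∃ w, s(v, w) ∈ G ∧ nbrProbe A (ident v) (k + 1) = ident w := by
  simp only [nbrProbe, vertex_ident]
  cases h : (A.list v)[k]? with
  | none => exact .inl rfl
  | some w =>
    by_cases hw : w ∈ (A.list v).take k
    · simp [hw]
    · exact .inr ⟨w, (mem_list A).1 (List.mem_of_getElem? h), by simp [hw]⟩

/-- The neighbour with the number `w` shows that `b` is not the highest-degree neighbour of `a`. -/
def Refutes (G : MGraph n) (a b : Fin n) (w : ℕ) : Prop :=
  w ≠ ident a ∧ (G.deg b < degProbe G w ∨ (degProbe G w = G.deg b ∧ ident b < w))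

theorem exists_refutes (A : AdjLists G) {a b : Fin n} (hab : b ≠ a) (h : s(a, b) ∈ G) :
    (∃ k < G.deg a, Refutes G a b (nbrProbe A (ident a) (k + 1))) ↔ ¬ IsTopNbr G a b := by
  have hb := deg_pos_right h
  constructor
  · rintro ⟨k, -, h1, h2⟩ ⟨-, -, h3⟩
    rcases nbrProbe_eq A a k with h0 | ⟨w, hw, h0⟩
    -- The answer `⊥` has degree `0`, which cannot compete because `b` has positive degree.
    · rw [h0, degProbe_zero] at h2; omega
    · rw [h0, degProbe_ident, ident_lt] at h2
      rw [h0, Ne, ident_inj] at h1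
      rcases h3 w h1 hw with h | h <;> rcases h2 with h2 | h2 <;> omega
  · intro hnot
    simp only [IsTopNbr, not_and, not_forall] at hnot
    obtain ⟨w, hw, hmem, hlt⟩ := hnot hab h
    obtain ⟨k, hk, hk'⟩ := exists_nbrProbe_eq A hmem
    refine ⟨k, hk, ?_⟩
    rw [hk', Refutes, degProbe_ident, Ne, ident_inj, ident_lt]
    refine ⟨hw, ?_⟩
    omega

end Probes

/-! ### Correctness and running time of the spanner program -/

section Program

/-- The program that does nothing useful. -/
def skipProg : Prog := .const 10 0

/-- Set the flag in register `9`, unless registers `6` and `0` agree. -/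
def flagProg : Prog := .ifLt 6 0 (.const 9 1) (.ifLt 0 6 (.const 9 1) skipProg)

/-- Inspect the next entry of the list of the vertex in register `0`. -/
def inspectProg : Prog :=
  .seq (.succ 4) (.seq (.nbr 6 0 4) (.seq (.deg 7 6)
    (.ifLt 8 7 flagProg (.ifLt 7 8 skipProg (.ifLt 1 6 flagProg skipProg)))))

/-- The preparation of the scan of an adjacency list. -/
def prepareProg : Prog :=
  .seq (.const 4 0) (.seq (.deg 5 0) (.seq (.deg 8 1) (.const 9 0)))

/-- Determine whether the vertex in register `1` is the highest-degree neighbour of the vertex in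
register `0`; if so, register `9` is zero at the end. -/
def scanProg : Prog := .seq prepareProg (.whileLt 4 5 inspectProg)

/-- Save the result of the first scan, and exchange the two vertices. -/
def exchangeProg : Prog := .seq (.copy 11 9) (.seq (.copy 12 0) (.seq (.copy 0 1) (.copy 1 12)))

/-- Combine the results of the two scans. -/
def combineProg : Prog :=
  .seq (.const 0 1) (.seq (.const 3 0) (.ifLt 3 9 (.ifLt 3 11 (.const 0 0) skipProg) skipProg))

/-- Scan the adjacency lists of both vertices. -/
def scanBothProg : Prog := .seq scanProg (.seq exchangeProg (.seq scanProg combineProg))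

/-- The program that answers queries to the spanner. -/
def spannerProg : Prog :=
  .seq (.const 3 1) (.ifLt 3 2 (.const 0 0)
    (.ifLt 0 1 scanBothProg (.ifLt 1 0 scanBothProg (.const 0 0))))

variable {n : ℕ} {G : MGraph n}

/-- Registers `0` and `1` hold the two ends, `4` the list position, `5` the length of the list, `6`
and `7` the current neighbour and its degree, `8` the degree of `b`, `9` the flag, and `11` the flag
saved from the first scan. -/
theorem inspectProg_run (A : AdjLists G) (a b : Fin n) {s : ℕ → ℕ} (h0 : s 0 = ident a)
    (h1 : s 1 = ident b) (h8 : s 8 = G.deg b) :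
    (inspectProg.run A s) 0 = s 0 ∧ (inspectProg.run A s) 1 = s 1 ∧
    (inspectProg.run A s) 4 = s 4 + 1 ∧ (inspectProg.run A s) 5 = s 5 ∧
    (inspectProg.run A s) 8 = s 8 ∧ (inspectProg.run A s) 11 = s 11 ∧
    ((inspectProg.run A s) 9 ≠ 0 ↔
      s 9 ≠ 0 ∨ Refutes G a b (nbrProbe A (ident a) (s 4 + 1))) := by
  simp only [inspectProg, flagProg, skipProg, Prog.run, Refutes]
  simp only [Function.update_apply]
  norm_num [h0, h1, h8]
  generalize nbrProbe A (ident a) (s 4 + 1) = w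
  split_ifs <;> (try simp) <;> omega

/-- Induction on the number `r` of entries not yet inspected. -/
theorem scan_loop (A : AdjLists G) (a b : Fin n) (r : ℕ) {s : ℕ → ℕ} (h0 : s 0 = ident a)
    (h1 : s 1 = ident b) (h8 : s 8 = G.deg b) (hr : s 4 + r = s 5) :
    ∃ t ≤ (inspectProg.size + 1) * r + 1, ∃ s', Exec A (.whileLt 4 5 inspectProg) s t s' ∧
      s' 0 = s 0 ∧ s' 1 = s 1 ∧ s' 11 = s 11 ∧
      (s' 9 ≠ 0 ↔ s 9 ≠ 0 ∨
        ∃ k < r, Refutes G a b (nbrProbe A (ident a) (s 4 + k + 1))) := by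
  induction r generalizing s with
  | zero =>
    exact ⟨1, by simp, s, .whileFalse (by omega), rfl, rfl, rfl, by simp⟩
  | succ r ih =>
    obtain ⟨t₁, ht₁, e₁⟩ := Prog.Straight.exec A (P := inspectProg)
      (by simp [inspectProg, flagProg, skipProg, Prog.Straight]) s
    obtain ⟨i0, i1, i4, i5, i8, i11, i9⟩ := inspectProg_run A a b h0 h1 h8
    obtain ⟨t₂, ht₂, s', e₂, j0, j1, j11, j9⟩ := ih (i0.trans h0) (i1.trans h1) (i8.trans h8)
      (by omega)
    refine ⟨t₁ + t₂ + 1, ?_, s', .whileTrue (by omega) e₁ e₂, j0.trans i0, j1.trans i1,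
      j11.trans i11, ?_⟩
    · rw [mul_add, mul_one]; omega
    · rw [j9, i9, i4, or_assoc, Nat.exists_lt_succ_left]
      simp only [zero_add, add_assoc, add_comm, add_left_comm]

theorem scanProg_exec (A : AdjLists G) {a b : Fin n} (hab : b ≠ a) (h : s(a, b) ∈ G)
    {s : ℕ → ℕ} (h0 : s 0 = ident a) (h1 : s 1 = ident b) :
    ∃ t ≤ (inspectProg.size + 1) * G.deg a + 5, ∃ s', Exec A scanProg s t s' ∧
      s' 0 = s 0 ∧ s' 1 = s 1 ∧ s' 11 = s 11 ∧ (s' 9 ≠ 0 ↔ ¬ IsTopNbr G a b) := by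
  obtain ⟨t₁, ht₁, e₁⟩ := Prog.Straight.exec A (P := prepareProg)
    (by simp [prepareProg, Prog.Straight]) s
  have hsize : prepareProg.size = 4 := rfl
  set s₁ := prepareProg.run A s with hs₁
  have p0 : s₁ 0 = s 0 := by simp [hs₁, prepareProg, Prog.run]
  have p1 : s₁ 1 = s 1 := by simp [hs₁, prepareProg, Prog.run]
  have p4 : s₁ 4 = 0 := by simp [hs₁, prepareProg, Prog.run]
  have p5 : s₁ 5 = G.deg a := by simp [hs₁, prepareProg, Prog.run, h0, degProbe_ident]
  have p8 : s₁ 8 = G.deg b := by simp [hs₁, prepareProg, Prog.run, h1, degProbe_ident]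
  have p9 : s₁ 9 = 0 := by simp [hs₁, prepareProg, Prog.run]
  have p11 : s₁ 11 = s 11 := by simp [hs₁, prepareProg, Prog.run]
  obtain ⟨t₂, ht₂, s', e₂, j0, j1, j11, j9⟩ := scan_loop A a b (G.deg a) (p0.trans h0)
    (p1.trans h1) p8 (by omega)
  refine ⟨t₁ + t₂, by omega, s', .seq e₁ e₂, j0.trans p0, j1.trans p1, j11.trans p11, ?_⟩
  rw [j9, p9, p4, ← exists_refutes A hab h]
  simp

theorem scanBothProg_exec (A : AdjLists G) {a b : Fin n} (hab : a ≠ b) (h : s(a, b) ∈ G)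
    {s : ℕ → ℕ} (h0 : s 0 = ident a) (h1 : s 1 = ident b) :
    ∃ t ≤ (inspectProg.size + 1) * (G.deg a + G.deg b) + 21, ∃ s', Exec A scanBothProg s t s' ∧
      (s' 0 ≠ 0 ↔ IsTopNbr G a b ∨ IsTopNbr G b a) := by
  obtain ⟨t₁, ht₁, s₁, e₁, i0, i1, -, i9⟩ := scanProg_exec A hab.symm h h0 h1
  obtain ⟨t₂, ht₂, e₂⟩ := Prog.Straight.exec A (P := exchangeProg)
    (by simp [exchangeProg, Prog.Straight]) s₁
  set s₂ := exchangeProg.run A s₁ with hs₂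
  have p0 : s₂ 0 = s₁ 1 := by simp [hs₂, exchangeProg, Prog.run]
  have p1 : s₂ 1 = s₁ 0 := by simp [hs₂, exchangeProg, Prog.run]
  have p11 : s₂ 11 = s₁ 9 := by simp [hs₂, exchangeProg, Prog.run]
  obtain ⟨t₃, ht₃, s₃, e₃, j0, j1, j11, j9⟩ := scanProg_exec A hab
    (show s(b, a) ∈ G by rwa [Sym2.eq_swap]) (p0.trans (i1.trans h1)) (p1.trans (i0.trans h0))
  obtain ⟨t₄, ht₄, e₄⟩ := Prog.Straight.exec A (P := combineProg)
    (by simp [combineProg, skipProg, Prog.Straight]) s₃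
  have hsize : exchangeProg.size = 4 := rfl
  have hsize' : combineProg.size = 7 := rfl
  refine ⟨t₁ + (t₂ + (t₃ + t₄)), ?_, _, .seq e₁ (.seq e₂ (.seq e₃ e₄)), ?_⟩
  · rw [mul_add]; omega
  · have hc : (combineProg.run A s₃) 0 ≠ 0 ↔ ¬ (s₃ 9 ≠ 0 ∧ s₃ 11 ≠ 0) := by
      simp only [combineProg, skipProg, Prog.run, Function.update_apply]
      norm_num
      split_ifs <;> (try simp) <;> omega
    rw [hc, j9, j11, p11, i9, not_and_or, not_not, not_not, or_comm]

theorem mem_queries {q : Query n} (hq : q ∈ queries G) :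
    1 ≤ q.2.2 ∧ s(q.1, q.2.1) ∈ G := by
  have h := (Finset.mem_filter.1 hq).2
  exact ⟨h.1, Multiset.one_le_count_iff_mem.1 (h.1.trans h.2)⟩

theorem spannerProg_exec (A : AdjLists G) {q : Query n} (hq : q ∈ queries G) :
    ∃ t ≤ (inspectProg.size + 32) * (G.deg q.1 + G.deg q.2.1), ∃ s,
      Exec A spannerProg q.init t s ∧ (s 0 ≠ 0 ↔ q.edge ∈ topSpanner G) := by
  obtain ⟨a, b, i⟩ := q
  obtain ⟨hi, hab⟩ := mem_queries hq
  simp only at hi hab ⊢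
  have hpos := deg_pos_left hab
  have hmem : (Query.edge (a, b, i)) ∈ topSpanner G ↔
      i = 1 ∧ (IsTopNbr G a b ∨ IsTopNbr G b a) := by
    simp only [topSpanner, Query.edge, Set.mem_ofPred_eq]
    refine and_congr_right fun _ => ⟨?_, ?_⟩
    · rintro ⟨u, v, h, htop⟩
      rcases Sym2.eq_iff.1 h with ⟨rfl, rfl⟩ | ⟨rfl, rfl⟩
      · exact .inl htop
      · exact .inr htop
    · rintro (h | h)
      · exact ⟨a, b, rfl, h⟩
      · exact ⟨b, a, Sym2.eq_swap, h⟩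
  set s₁ := Function.update (Query.init (a, b, i)) 3 1 with hs₁
  have e₁ : Exec A (.const 3 1) (Query.init (a, b, i)) 1 s₁ := .const _ _ _
  have p0 : s₁ 0 = ident a := by simp [hs₁, Query.init]
  have p1 : s₁ 1 = ident b := by simp [hs₁, Query.init]
  have p2 : s₁ 2 = i := by simp [hs₁, Query.init]
  have p3 : s₁ 3 = 1 := by simp [hs₁]
  -- The additive overhead is absorbed because the ends of an edge have positive degree.
  have hbound : (inspectProg.size + 1) * (G.deg a + G.deg b) + 30 ≤
      (inspectProg.size + 32) * (G.deg a + G.deg b) := by nlinarith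
  by_cases hi1 : 1 < i
  · refine ⟨1 + (1 + 1), by nlinarith, _,
      .seq e₁ (.ifTrue (by rw [p2, p3]; exact hi1) (.const 0 0 _)), ?_⟩
    rw [hmem]
    simp
    omega
  have hi' : i = 1 := by omega
  have hif : ¬ s₁ 3 < s₁ 2 := by rw [p2, p3]; exact hi1
  rw [hmem]
  by_cases hne : a = b
  · subst hne
    refine ⟨1 + (1 + 1 + 1 + 1), by omega, _, .seq e₁ (.ifFalse hif (.ifFalse (by omega)
      (.ifFalse (by omega) (.const 0 0 _)))), ?_⟩
    simp [IsTopNbr]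
  · obtain ⟨t, ht, s', e, h⟩ := scanBothProg_exec A hne hab p0 p1
    rw [← h]
    rcases lt_or_gt_of_ne hne with hlt | hlt
    · exact ⟨1 + (t + 1 + 1), by omega, s', .seq e₁ (.ifFalse hif (.ifTrue
        (by rw [p0, p1]; exact ident_lt.2 hlt) e)), by simp [hi']⟩
    · exact ⟨1 + (t + 1 + 1 + 1), by omega, s', .seq e₁ (.ifFalse hif (.ifFalse
        (by rw [p0, p1, ident_lt]; exact hlt.not_gt)
        (.ifTrue (by rw [p0, p1]; exact ident_lt.2 hlt) e))), by simp [hi']⟩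

open Classical in
/-- The running time of the program. -/
noncomputable def spannerTime {n : ℕ} {G : MGraph n} (A : AdjLists G) (q : Query n) : ℕ :=
  if hq : q ∈ queries G then (spannerProg_exec A hq).choose else 0

theorem spannerTime_spec (A : AdjLists G) {q : Query n} (hq : q ∈ queries G) :
    spannerTime A q ≤ (inspectProg.size + 32) * (G.deg q.1 + G.deg q.2.1) ∧ ∃ s,
      Exec A spannerProg q.init (spannerTime A q) s ∧ (s 0 ≠ 0 ↔ q.edge ∈ topSpanner G) := by
  rw [spannerTime, dif_pos hq]
  exact (spannerProg_exec A hq).choose_spec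

end Program

/-! ### Typical graphs -/

section Typical

variable {n : ℕ}

/-- The number of vertices that start the process, which are to form a clique, is less than this;
each later vertex `i` is to have a neighbour whose arrival time is smaller by this factor. -/
def coreSize : ℕ := 5184

/-- What holds with high probability; `π v` is the arrival time of the vertex `v`. -/
structure Typical (μ : ℕ) (π : Equiv.Perm (Fin n)) (G : MGraph n) : Prop where
  card : Multiset.card G = μ * n
  deg_le : ∀ v, (G.deg v : ℝ) ≤ 6 * μ * gain n μ (π v)
  le_deg : ∀ v, μ / 3 * gain n μ (π v) ≤ G.deg v
  early : ∀ u v, π v < π u → (π u).val + 1 < coreSize → s(u, v) ∈ G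
  late : ∀ u, coreSize ≤ (π u).val + 1 →
    ∃ w, s(u, w) ∈ G ∧ ((π w).val + 1) * coreSize ≤ (π u).val + 1

theorem Typical.relabel {μ : ℕ} {G : MGraph n} (h : Typical μ 1 G) (σ : Equiv.Perm (Fin n)) :
    Typical μ σ.symm (G.map (Sym2.map σ)) := by
  have hσ : ∀ p : Fin n → Prop, (∀ v, p (σ v)) → ∀ v, p v := fun p hp v => by
    simpa using hp (σ.symm v)
  constructor
  · rw [Multiset.card_map, h.card]
  · refine hσ _ fun v => ?_
    rw [deg_map_relabel, Equiv.symm_apply_apply]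
    exact h.deg_le v
  · refine hσ _ fun v => ?_
    rw [deg_map_relabel, Equiv.symm_apply_apply]
    exact h.le_deg v
  · refine hσ _ fun u => hσ _ fun v => ?_
    rw [mem_map_relabel, Equiv.symm_apply_apply, Equiv.symm_apply_apply]
    exact h.early u v
  · refine hσ _ fun u hu => ?_
    rw [Equiv.symm_apply_apply] at hu
    obtain ⟨w, hw, hw'⟩ := h.late u hu
    refine ⟨σ w, (mem_map_relabel G σ u w).2 hw, ?_⟩
    rwa [Equiv.symm_apply_apply, Equiv.symm_apply_apply]

/-- With the companion below, `gain` is `√(n / (v + 1))` up to a factor `√2` either way, uniformly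
in `μ`. -/
theorem gain_sq_le {μ : ℕ} (hμ : 1 ≤ μ) (v : Fin n) :
    gain n μ v ^ 2 ≤ 2 * n / (v.val + 1) := by
  have hn : 1 ≤ n := by have := v.isLt; omega
  have h1 := growth_sq_le (Nat.mul_pos hμ hn)
  have h2 := growth_sq_ge (μ * (v.val + 1))
  have hμ' : (0 : ℝ) < μ := by exact_mod_cast hμ
  push_cast at h1 h2
  rw [gain, div_pow, div_le_div_iff₀ (pow_pos (growth_pos _) 2) (by positivity)]
  calc _ ≤ 4 * (μ * (n : ℝ)) * (v.val + 1) := by gcongr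
    _ = 2 * n * (2 * (μ * (v.val + 1))) := by ring
    _ ≤ _ := by gcongr; linarith

theorem le_gain_sq {μ : ℕ} (hμ : 1 ≤ μ) (v : Fin n) :
    n / (2 * (v.val + 1)) ≤ gain n μ v ^ 2 := by
  have h1 := growth_sq_le (Nat.mul_pos hμ (Nat.succ_pos v.val))
  have h2 := growth_sq_ge (μ * n)
  have hμ' : (0 : ℝ) < μ := by exact_mod_cast hμ
  push_cast at h1 h2
  rw [gain, div_pow, div_le_div_iff₀ (by positivity) (pow_pos (growth_pos _) 2)]
  calc _ ≤ (n : ℝ) * (4 * (μ * (v.val + 1))) := by gcongr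
    _ = 2 * (μ * n) * (2 * (v.val + 1)) := by ring
    _ ≤ _ := by gcongr; linarith

namespace Typical

variable {μ : ℕ} {π : Equiv.Perm (Fin n)} {G : MGraph n}

theorem deg_sq_le (h : Typical μ π G) (hμ : 1 ≤ μ) (v : Fin n) :
    (G.deg v : ℝ) ^ 2 ≤ 72 * μ ^ 2 * n * ((π v).val + 1 : ℝ)⁻¹ := by
  calc (G.deg v : ℝ) ^ 2 ≤ (6 * μ * gain n μ (π v)) ^ 2 := by
        gcongr; exact h.deg_le v
    _ = 36 * μ ^ 2 * gain n μ (π v) ^ 2 := by ring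
    _ ≤ 36 * μ ^ 2 * (2 * n / ((π v).val + 1)) := by gcongr; exact gain_sq_le hμ _
    _ = _ := by ring

theorem deg_le_sqrt (h : Typical μ π G) (hμ : 1 ≤ μ) (v : Fin n) :
    (G.deg v : ℝ) ≤ 9 * (μ * Real.sqrt n) := by
  refine abs_le_of_sq_le_sq' ?_ (by positivity) |>.2
  have h1 : ((π v).val + 1 : ℝ)⁻¹ ≤ 1 := inv_le_one_of_one_le₀ (by simp)
  calc _ ≤ 72 * (μ : ℝ) ^ 2 * n * ((π v).val + 1 : ℝ)⁻¹ := h.deg_sq_le hμ v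
    _ ≤ 72 * (μ : ℝ) ^ 2 * n * 1 := by gcongr
    _ ≤ 81 * (μ ^ 2 * n) := by nlinarith [(by positivity : (0 : ℝ) ≤ μ ^ 2 * n)]
    _ = _ := by rw [mul_pow, mul_pow, Real.sq_sqrt (Nat.cast_nonneg n)]; norm_num

theorem div_five_le_deg (h : Typical μ π G) (hμ : 1 ≤ μ) (v : Fin n) : (μ : ℝ) / 5 ≤ G.deg v := by
  refine le_trans ?_ (h.le_deg v)
  have hpos := gain_pos μ (π v)
  have h1 : (1 / 2 : ℝ) ≤ gain n μ (π v) ^ 2 := by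
    refine le_trans ?_ (le_gain_sq hμ (π v))
    rw [div_le_div_iff₀ (by norm_num) (by positivity)]
    have : ((π v).val + 1 : ℝ) ≤ n := by exact_mod_cast (π v).isLt
    linarith
  -- `(3/5)² < 1/2`, and `μ/3 · 3/5 = μ/5`.
  have h2 : (3 / 5 : ℝ) ≤ gain n μ (π v) := by nlinarith
  have hμ' : (0 : ℝ) < μ := by exact_mod_cast hμ
  nlinarith

theorem sum_deg_sq_le (h : Typical μ π G) (hμ : 1 ≤ μ) :
    ∑ v, (G.deg v : ℝ) ^ 2 ≤ 72 * μ ^ 2 * n * (1 + Real.log n) := by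
  calc _ ≤ ∑ v, 72 * (μ : ℝ) ^ 2 * n * ((π v).val + 1 : ℝ)⁻¹ :=
        Finset.sum_le_sum fun v _ => h.deg_sq_le hμ v
    _ = 72 * (μ : ℝ) ^ 2 * n * (harmonic n : ℝ) := by
        rw [← Finset.mul_sum, Equiv.sum_comp π fun v : Fin n => (v.val + 1 : ℝ)⁻¹,
          Fin.sum_univ_eq_sum_range fun i => (i + 1 : ℝ)⁻¹, harmonic]
        push_cast
        rfl
    _ ≤ _ := by gcongr; exact harmonic_le_one_add_log n

/-- This fixes `coreSize`. The tail constants `6` and `1/3` and the factor `2` require gains in the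
ratio `2 · 6 · 3 = 36`; the bounds on the squared gains lose another factor `4`, and `4 · 36² =
5184`. -/
theorem two_mul_deg_le (h : Typical μ π G) (hμ : 1 ≤ μ) {u w : Fin n}
    (huw : ((π w).val + 1) * coreSize ≤ (π u).val + 1) : 2 * G.deg u ≤ G.deg w := by
  have hu := gain_pos μ (π u)
  have hw := gain_pos μ (π w)
  have hn : (0 : ℝ) < n := by exact_mod_cast (Nat.zero_le _).trans_lt u.isLt
  have huw' : ((π w).val + 1 : ℝ) * 5184 ≤ (π u).val + 1 := by exact_mod_cast huw
  have key : 36 * gain n μ (π u) ≤ gain n μ (π w) := by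
    refine abs_le_of_sq_le_sq' ?_ hw.le |>.2
    calc (36 * gain n μ (π u)) ^ 2 = (1296 * gain n μ (π u) ^ 2 : ℝ) := by ring
      _ ≤ (1296 * (2 * n / ((π u).val + 1)) : ℝ) := by gcongr; exact gain_sq_le hμ _
      _ ≤ (n / (2 * ((π w).val + 1)) : ℝ) := by
        rw [← mul_div_assoc, div_le_div_iff₀ (by positivity) (by positivity)]
        nlinarith
      _ ≤ _ := le_gain_sq hμ _
  have h1 := h.deg_le u
  have h2 := h.le_deg w
  have hμ' : (0 : ℝ) < μ := by exact_mod_cast hμ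
  have : (2 * G.deg u : ℝ) ≤ G.deg w := by nlinarith
  exact_mod_cast this

theorem isSpanner (h : Typical μ π G) (hμ : 1 ≤ μ) (hn : 2 ≤ n) :
    IsSpanner G (topSpanner G) (2 * (7 + Nat.log 2 n : ℕ)) ∧ (topSpanner G).ncard = n - 1 := by
  have hne : Nonempty (Fin n) := ⟨⟨0, by omega⟩⟩
  have hlate : ∀ u, ¬ (π u).val + 1 < coreSize →
      ∃ w, w ≠ u ∧ s(u, w) ∈ G ∧ 2 * G.deg u ≤ G.deg w := by
    intro u hu
    obtain ⟨w, hw, hlt⟩ := h.late u (not_lt.1 hu)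
    refine ⟨w, ?_, hw, h.two_mul_deg_le hμ hlt⟩
    rintro rfl
    rw [coreSize] at hlt
    omega
  have hcore : ∀ u v, (π u).val + 1 < coreSize → (π v).val + 1 < coreSize → u ≠ v →
      s(u, v) ∈ G := by
    intro u v hu hv huv
    rcases lt_or_gt_of_ne (π.injective.ne huv) with hlt | hlt
    · rw [Sym2.eq_swap]; exact h.early v u hlt hv
    · exact h.early u v hlt hu
  refine isSpanner_of_core (core := fun u => (π u).val + 1 < coreSize) ?_ hcore hlate ?_
  · intro u
    by_cases hu : (π u).val + 1 < coreSize
    -- As `n ≥ 2`, the first two arrivals exist and both lie in the core: the first has the second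
    -- as a neighbour, and all other core vertices have the first.
    · by_cases h0 : (π u).val = 0
      · have hw : π (π.symm ⟨1, by omega⟩) = ⟨1, by omega⟩ := Equiv.apply_symm_apply _ _
        have hne : u ≠ π.symm ⟨1, by omega⟩ := by
          intro heq
          rw [← heq] at hw
          simp [hw] at h0
        exact ⟨_, hne.symm, hcore u _ hu (by rw [hw]; norm_num [coreSize]) hne⟩
      · have hw : π (π.symm ⟨0, by omega⟩) = ⟨0, by omega⟩ := Equiv.apply_symm_apply _ _
        have hne : u ≠ π.symm ⟨0, by omega⟩ := by
          intro heq
          rw [← heq] at hw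
          simp [hw] at h0
        exact ⟨_, hne.symm, hcore u _ hu (by rw [hw]; norm_num [coreSize]) hne⟩
    · obtain ⟨w, h1, h2, -⟩ := hlate u hu
      exact ⟨w, h1, h2⟩
  · intro u w
    have h1 := h.deg_le_sqrt hμ w
    have h2 := h.div_five_le_deg hμ u
    have h3 : (n : ℝ) < 2 ^ (Nat.log 2 n + 1) := by
      exact_mod_cast Nat.lt_pow_succ_log_self one_lt_two n
    have hn' : (2 : ℝ) ≤ n := by exact_mod_cast hn
    have h4 : Real.sqrt n ≤ n := by
      rw [Real.sqrt_le_left (by linarith)]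
      nlinarith
    have hμ' : (0 : ℝ) < μ := by exact_mod_cast hμ
    -- The degree ratio is at most `45 n`, while `64 n < 2 ^ (7 + Nat.log 2 n)`.
    have : (G.deg w : ℝ) < 2 ^ (7 + Nat.log 2 n) * G.deg u := by
      calc (G.deg w : ℝ) ≤ 9 * (μ * n) := h1.trans (by gcongr)
        _ < 64 * n * (μ / 5) := by nlinarith [mul_pos hμ' (by linarith : (0 : ℝ) < n)]
        _ ≤ 64 * 2 ^ (Nat.log 2 n + 1) * G.deg u := by gcongr
        _ = _ := by rw [show 7 + Nat.log 2 n = 6 + (Nat.log 2 n + 1) by ring, pow_add _ 6]; norm_num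
    exact_mod_cast this

end Typical

theorem IsSpanner.mono {G : MGraph n} {H : Set (Sym2 (Fin n) × ℕ)} {k k' : ℝ}
    (h : IsSpanner G H k) (hk : k ≤ k') : IsSpanner G H k' :=
  ⟨h.1, fun u v huv => ⟨(h.2 u v huv).1, (h.2 u v huv).2.trans (by gcongr)⟩⟩

theorem log_gt_of_two_le {n : ℕ} (hn : 2 ≤ n) : (0.69 : ℝ) < Real.log n := by
  have h2 : Real.log 2 ≤ Real.log n := Real.log_le_log (by norm_num) (by exact_mod_cast hn)
  linarith [Real.log_two_gt_d9]

theorem natLog_le_log {n : ℕ} (hn : 2 ≤ n) : (Nat.log 2 n : ℝ) * 0.69 ≤ Real.log n := by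
  have h1 : (2 : ℝ) ^ Nat.log 2 n ≤ n := by
    exact_mod_cast Nat.pow_log_le_self 2 (by omega)
  have h2 := Real.log_le_log (by positivity) h1
  rw [Real.log_pow] at h2
  have := Real.log_two_gt_d9
  nlinarith [(Nat.cast_nonneg (Nat.log 2 n) : (0 : ℝ) ≤ _)]

theorem Typical.conclusion {μ : ℕ} {π : Equiv.Perm (Fin n)} {G : MGraph n} (h : Typical μ π G)
    (hμ : 1 ≤ μ) (hn : 2 ≤ n) {T : AdjLists G → Query n → ℕ} {c : ℝ} (hc : 1 ≤ c)
    (hT : ∀ A, ∀ q ∈ queries G, (T A q : ℝ) ≤ c * ((G.deg q.1 : ℝ) + (G.deg q.2.1 : ℝ))) :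
    IsSpanner G (topSpanner G) (1000 * c * Real.log n) ∧
      (topSpanner G).ncard = n - 1 ∧
      ∀ A : AdjLists G,
        (∀ q ∈ queries G, (T A q : ℝ) ≤ 1000 * c * ((μ : ℝ) * Real.sqrt n)) ∧
        avgTime G (T A) ≤ 1000 * c * ((μ : ℝ) * Real.log n ^ 3) := by
  obtain ⟨h1, h2⟩ := h.isSpanner hμ hn
  have hlog := log_gt_of_two_le hn
  have hμ' : (0 : ℝ) < μ := by exact_mod_cast hμ
  have hn' : (0 : ℝ) < n := by exact_mod_cast (by omega : 0 < n)
  refine ⟨h1.mono ?_, h2, fun A => ⟨fun q hq => ?_, ?_⟩⟩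
  · have := natLog_le_log hn
    push_cast
    nlinarith
  · refine (hT A q hq).trans ?_
    have ha := h.deg_le_sqrt hμ q.1
    have hb := h.deg_le_sqrt hμ q.2.1
    have : 0 ≤ c * (μ * Real.sqrt n) := by positivity
    nlinarith
  · refine (avgTime_le (by linarith) (hT A) (by rw [h.card]; positivity)).trans ?_
    rw [h.card, div_le_iff₀ (by positivity)]
    push_cast
    have hs := h.sum_deg_sq_le hμ
    -- Uses `log n > 0.69`; only here is the linear logarithmic bound weakened to a cubic one.
    have hcube : 1 + Real.log n ≤ 6 * Real.log n ^ 3 := by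
      nlinarith [mul_pos (by linarith : (0 : ℝ) < Real.log n) (by linarith : (0 : ℝ) < Real.log n)]
    calc _ ≤ c * (2 * (72 * μ ^ 2 * n * (6 * Real.log n ^ 3))) := by
          gcongr
          exact hs.trans (by gcongr)
      _ = 864 * (c * (μ ^ 2 * n * Real.log n ^ 3)) := by ring
      _ ≤ 1000 * (c * (μ ^ 2 * n * Real.log n ^ 3)) := by gcongr; norm_num
      _ = _ := by ring

end Typical

/-! ### The probability of typical graphs -/

section Probability

variable {n : ℕ}

/-- The vertices that arrive earlier than `u` by a large factor. -/
def muchEarlier (u : Fin n) : Finset (Fin n) :=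
  Finset.univ.filter fun j => (j.val + 1) * coreSize ≤ u.val + 1

theorem lt_of_mem_muchEarlier {u j : Fin n} (h : j ∈ muchEarlier u) : j < u := by
  have := (Finset.mem_filter.1 h).2
  rw [coreSize] at this
  rw [Fin.lt_def]
  omega

theorem card_muchEarlier (u : Fin n) : (muchEarlier u).card = (u.val + 1) / coreSize := by
  have hle : (u.val + 1) / coreSize ≤ n := (Nat.div_le_self _ _).trans u.isLt
  have : muchEarlier u = Finset.univ.filter fun j : Fin n => j.val < (u.val + 1) / coreSize := by
    refine Finset.filter_congr fun j _ => ?_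
    rw [← Nat.le_div_iff_mul_le (by norm_num [coreSize])]
    rfl
  rw [this, Fin.card_filter_val_lt, min_eq_right hle]

open Classical in
/-- A bound for the indicator of the graphs that are not typical. -/
theorem not_typical_le {μ : ℕ} {G : MGraph n} (hcard : Multiset.card G = μ * n) :
    (if Typical μ 1 G then 0 else 1 : ℝ≥0∞) ≤
      ∑ u : Fin n, ((if 6 * μ * gain n μ u < G.deg u then 1 else 0) +
        ((if (G.deg u : ℝ) < μ / 3 * gain n μ u then 1 else 0) +
        ((if coreSize ≤ u.val + 1 then misses u (muchEarlier u) G else 0) +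
        ∑ v : Fin n, if v < u ∧ u.val + 1 < coreSize then misses u {v} G else 0))) := by
  split_ifs with hG
  · exact zero_le
  · by_contra hlt
    -- A sum of indicators below `1` has no indicator equal to `1`, so no failure occurs.
    have hsmall : ∀ u : Fin n, _ := fun u => (Finset.single_le_sum
      (f := fun u : Fin n => ((if 6 * μ * gain n μ u < G.deg u then 1 else 0) +
        ((if (G.deg u : ℝ) < μ / 3 * gain n μ u then 1 else 0) +
        ((if coreSize ≤ u.val + 1 then misses u (muchEarlier u) G else 0) +
        ∑ v : Fin n, if v < u ∧ u.val + 1 < coreSize then misses u {v} G else 0)) : ℝ≥0∞))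
      (fun _ _ => zero_le) (Finset.mem_univ u)).trans_lt (not_le.1 hlt)
    apply hG
    have habs : ∀ {a b : ℝ≥0∞}, a + b < 1 → a < 1 ∧ b < 1 := fun h =>
      ⟨le_self_add.trans_lt h, le_add_self.trans_lt h⟩
    refine ⟨hcard, fun v => ?_, fun v => ?_, fun u v hvu hu => ?_, fun u hu => ?_⟩
    · by_contra h
      have := (habs (hsmall v)).1
      exact lt_irrefl _ ((if_pos (not_le.1 h)).ge.trans_lt this)
    · by_contra h
      have := (habs (habs (hsmall v)).2).1
      exact lt_irrefl _ ((if_pos (not_le.1 h)).ge.trans_lt this)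
    · by_contra h
      have h1 := (habs (habs (habs (hsmall u)).2).2).2
      have h2 := (Finset.single_le_sum (f := fun v : Fin n =>
        if v < u ∧ u.val + 1 < coreSize then misses u {v} G else 0)
        (fun _ _ => zero_le) (Finset.mem_univ v)).trans_lt h1
      rw [if_pos ⟨hvu, hu⟩, misses, if_neg (by simpa using h)] at h2
      exact lt_irrefl _ h2
    · by_contra h
      have h1 := (habs (habs (habs (hsmall u)).2).2).1
      rw [if_pos (show coreSize ≤ u.val + 1 from hu), misses, if_neg] at h1
      · exact lt_irrefl _ h1
      · rintro ⟨w, hw, hmem⟩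
        exact h ⟨w, hmem, (Finset.mem_filter.1 hw).2⟩

open Classical in
-- A union bound over at most `3 + n` failures per vertex. The weakest of their exponents is `μ / (4
-- * coreSize)`, which comes from missing the much earlier vertices.
theorem expect_not_typical {μ : ℕ} (hμ : 1 ≤ μ) :
    expect (process n μ) (fun G => if Typical μ 1 G then 0 else 1) ≤
      ENNReal.ofReal (n * (3 + n) * Real.exp (-(μ / (4 * coreSize)))) := by
  set x := ENNReal.ofReal (Real.exp (-(μ / (4 * coreSize)))) with hx
  have hμ0 : (0 : ℝ) ≤ μ := Nat.cast_nonneg μ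
  have hle : ∀ y : ℝ, 1 / (4 * coreSize) ≤ y → ENNReal.ofReal (Real.exp (-(μ * y))) ≤ x := by
    intro y hy
    apply ENNReal.ofReal_le_ofReal
    rw [Real.exp_le_exp, neg_le_neg_iff, div_eq_mul_one_div]
    gcongr
  rw [process_eq_rounds]
  calc _ ≤ ∑ u : Fin n, (x + (x + (x + ∑ v : Fin n, x))) := by
        refine (expect_mono fun G hG => not_typical_le (afterRounds le_rfl hG).card).trans ?_
        rw [expect_sum]
        refine Finset.sum_le_sum fun u _ => ?_
        rw [expect_add, expect_add, expect_add, expect_sum]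
        gcongr with v
        · refine (expect_large_deg u).trans ?_
          simpa using hle 1 (by norm_num [coreSize])
        · refine (expect_small_deg u).trans ?_
          simpa [div_eq_mul_inv] using hle (1 / 6) (by norm_num [coreSize])
        · by_cases hu : coreSize ≤ u.val + 1
          · simp only [hu, if_true]
            refine (expect_misses hμ (fun j hj => lt_of_mem_muchEarlier hj)
              (q := 1 / (4 * coreSize)) ?_).trans (hle _ le_rfl)
            rw [card_muchEarlier, div_le_div_iff₀ (by norm_num [coreSize]) (by positivity)]
            -- Rounding down loses at most a factor `2`, since the quotient is at least one.
            have : u.val + 1 ≤ 2 * ((u.val + 1) / coreSize * coreSize) := by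
              rw [coreSize] at hu ⊢
              omega
            have : (u.val + 1 : ℝ) ≤ 2 * (((u.val + 1) / coreSize : ℕ) * coreSize) := by
              exact_mod_cast this
            linarith
          · simp only [hu, if_false]
            exact (expect_const _ 0).le.trans zero_le
        · by_cases hu : v < u ∧ u.val + 1 < coreSize
          · simp only [hu, and_self, if_true]
            refine (expect_misses hμ (A := {v}) (by simpa using hu.1)
              (q := 1 / (4 * coreSize)) ?_).trans (hle _ le_rfl)
            rw [Finset.card_singleton, Nat.cast_one]
            have : (u.val + 1 : ℝ) ≤ coreSize := by exact_mod_cast hu.2.le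
            gcongr
            linarith
          · simp only [hu, if_false]
            exact (expect_const _ 0).le.trans zero_le
    _ = _ := by
      have hn : (n : ℝ≥0∞) = ENNReal.ofReal n := (ENNReal.ofReal_natCast n).symm
      have h3 : (3 : ℝ≥0∞) = ENNReal.ofReal 3 := by simp
      simp only [Finset.sum_const, Finset.card_univ, Fintype.card_fin, nsmul_eq_mul]
      rw [ENNReal.ofReal_mul (by positivity), ENNReal.ofReal_mul (by positivity),
        ENNReal.ofReal_add (by positivity) (by positivity), ← hx, ← hn, ← h3]
      ring

theorem failure_le_inv {μ : ℕ} (hn : 2 ≤ n) (hμ : 20 * coreSize * Real.log n < μ) :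
    n * (3 + n) * Real.exp (-(μ / (4 * coreSize))) ≤ 1 / (n : ℝ) := by
  have hn' : (2 : ℝ) ≤ n := by exact_mod_cast hn
  -- The constant `20 = 4 · 5` gives the fifth power: four to beat `n (3 + n) ≤ n ^ 4`, and one for
  -- the failure probability.
  have hexp : Real.exp (-(μ / (4 * coreSize))) ≤ ((n : ℝ) ^ 5)⁻¹ := by
    rw [Real.exp_neg]
    refine inv_anti₀ (by positivity) ?_
    rw [← Real.log_le_iff_le_exp (by positivity), Real.log_pow, le_div_iff₀ (by norm_num [coreSize])]
    push_cast
    linarith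
  calc _ ≤ n * (3 + n) * ((n : ℝ) ^ 5)⁻¹ := by gcongr
    _ ≤ n ^ 4 * ((n : ℝ) ^ 5)⁻¹ := by
      gcongr
      nlinarith [mul_self_nonneg (n : ℝ), mul_nonneg (sub_nonneg.2 hn') (sub_nonneg.2 hn'),
        pow_le_pow_left₀ (by norm_num) hn' 2, pow_le_pow_left₀ (by norm_num) hn' 3]
    _ = _ := by field_simp

open Classical in
-- Typicality moves along with any relabelling, so from a typical outcome of the process the final
-- permutation lands in `S` with probability one.
theorem Gpa_ge {μ : ℕ} (hn : 2 ≤ n) (hμ : 20 * coreSize * Real.log n < μ) {S : Set (MGraph n)}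
    (hS : ∀ (π : Equiv.Perm (Fin n)) G, Typical μ π G → G ∈ S) :
    1 - 1 / (n : ℝ≥0∞) ≤ (Gpa n μ).toOuterMeasure S := by
  have hμ1 : 1 ≤ μ := by
    have := log_gt_of_two_le hn
    have : (0 : ℝ) < μ := lt_of_le_of_lt (by positivity) hμ
    exact_mod_cast this
  have hfail : expect (process n μ) (fun G => if Typical μ 1 G then 0 else 1) ≤
      1 / (n : ℝ≥0∞) := by
    refine ((expect_not_typical hμ1).trans
      (ENNReal.ofReal_le_ofReal (failure_le_inv hn hμ))).trans ?_
    rw [ENNReal.ofReal_div_of_pos (by exact_mod_cast (by omega : 0 < n)), ENNReal.ofReal_one,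
      ENNReal.ofReal_natCast]
  have hone : expect (process n μ) (fun G => if Typical μ 1 G then 1 else 0) +
      expect (process n μ) (fun G => if Typical μ 1 G then 0 else 1) = 1 := by
    rw [← expect_add]
    refine (congrArg (expect _) (funext fun G => ?_)).trans (expect_const _ 1)
    split_ifs <;> simp
  have hsucc : expect (process n μ) (fun G => if Typical μ 1 G then 1 else 0) ≤
      (Gpa n μ).toOuterMeasure S := by
    rw [Gpa, PMF.toOuterMeasure_bind_apply]
    refine expect_mono (g := fun G => PMF.toOuterMeasure _ S) fun G _ => ?_
    split_ifs with h
    · refine ((PMF.toOuterMeasure_apply_eq_one_iff _ _).2 ?_).ge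
      intro G' hG'
      obtain ⟨_, hσ, rfl⟩ := (PMF.mem_support_map_iff _ _ _).1 hG'
      obtain ⟨σ, -, hσ⟩ := (PMF.mem_support_bind_iff _ _ _).1 hσ
      obtain rfl := (PMF.mem_support_pure_iff _ _).1 hσ
      exact hS _ _ (h.relabel σ)
    · exact zero_le
  rw [tsub_le_iff_right]
  exact hone.ge.trans (add_le_add hsucc hfail)

end Probability

end PALCA

theorem theorem1p8 :
    ∃ (P : Prog) (c C : ℝ)
      (T : ∀ {n : ℕ} {G : MGraph n}, AdjLists G → Query n → ℕ),
      0 < c ∧ 0 < C ∧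
      (∀ (n : ℕ) (G : MGraph n) (A : AdjLists G),
        GivesAccess A P (topSpanner G) (T A) ∧
        ∀ q ∈ queries G, (T A q : ℝ) ≤ C * ((G.deg q.1 : ℝ) + (G.deg q.2.1 : ℝ))) ∧
      ∀ (n μ : ℕ), 2 ≤ n → c * Real.log n < (μ : ℝ) →
        1 - 1 / (n : ENNReal) ≤ (Gpa n μ).toOuterMeasure
          {G : MGraph n |
            IsSpanner G (topSpanner G) (C * Real.log n) ∧
            (topSpanner G).ncard = n - 1 ∧
            ∀ A : AdjLists G,
              (∀ q ∈ queries G, (T A q : ℝ) ≤ C * ((μ : ℝ) * Real.sqrt n)) ∧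
              avgTime G (T A) ≤ C * ((μ : ℝ) * Real.log n ^ 3)} := by
  have hc : (1 : ℝ) ≤ (inspectProg.size + 32 : ℕ) := by exact_mod_cast (by omega)
  have hT : ∀ (n : ℕ) (G : MGraph n) (A : AdjLists G), ∀ q ∈ queries G,
      (spannerTime A q : ℝ) ≤
        (inspectProg.size + 32 : ℕ) * ((G.deg q.1 : ℝ) + (G.deg q.2.1 : ℝ)) :=
    fun n G A q hq => by exact_mod_cast (spannerTime_spec A hq).1
  refine ⟨spannerProg, 20 * coreSize, 1000 * (inspectProg.size + 32 : ℕ), @spannerTime,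
    by norm_num [coreSize], by linarith, fun n G A => ⟨fun q hq => (spannerTime_spec A hq).2,
      fun q hq => (hT n G A q hq).trans ?_⟩, fun n μ hn hμ => ?_⟩
  · gcongr
    linarith
  · refine Gpa_ge hn hμ fun π G h => h.conclusion ?_ hn hc (hT n G)
    have := log_gt_of_two_le hn
    have : (0 : ℝ) < μ := lt_of_le_of_lt (by positivity) hμ
    exact_mod_cast this
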